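/- **Setting.** Let $d,n\ge 1$, $\lambda\in(0,1)$. Draw $\theta$ uniformly from $\{\pm1\}^d$; given $\theta$, let $\mathcal P_\theta=\mathrm{BSC}_{(1-\lambda)/2}(\theta)$ be the law of the vector obtained from $\theta$ by flipping each coordinate independently with probability $(1-\lambda)/2$, and let $\mathcal P_0$ be the uniform distribution on $\{\pm1\}^d$ (the marginal of $\mathcal P_\theta$). A learner $\mathcal A$ with finite model space $\mathcal M$ receives $X_1,\dots,X_n\overset{iid}{\sim}\mathcal P_\theta$ and outputs, possibly with randomization, a model in $\mathcal M$, where every model is used as a classifier $h:\{\pm1\}^d\to\{0,1\}$. The error of $h$ is $\tfrac12\Pr_{X\sim\mathcal P_\theta}[h(X)\ne1]+\tfrac12\Pr_{X\sim\mathcal P_0}[h(X)\ne0]$; $\mathrm{err}(\mathcal A)$ is its expectation over $\theta$, $X_{1:n}$ and the randomness of $\mathcal A$. The excess memorization is $\mathrm{mem}_n(\mathcal A)=\mathbb E_\theta\,[I(\mathcal A(X_{1:n});X_{1:n})]$ with $X_{1:n}\sim\mathcal P_\theta^n$ inside the mutual information, that is, $I(\mathcal A(X_{1:n});X_{1:n}\mid\theta)$.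 Let $\mathrm{mem}_n(\mathcal M,\alpha)$ be the infimum of $\mathrm{mem}_n(\mathcal A)$ over the learners with model space $\mathcal M$ and $\mathrm{err}(\mathcal A)\le\alpha$ ($+\infty$ if there are none), and $C_\alpha=(1-2\alpha)\log\frac{1-\alpha}{\alpha}$. **Theorem.** There are absolute constants $\kappa,K_1,K_2,C_0>0$ such that for every $C\ge C_0$ the following hold for all $d\ge1$ for which $\lambda=C d^{-1/4}$ lies in $(0,1)$. 1. There is a learner with $n=1$ sample and error at most $0.01$. 2. For every $n\ge1$, every finite $\mathcal M$ and every $0<\alpha<\frac12$, with $L=\log(dn\log|\mathcal M|/C_\alpha)$, $$\mathrm{mem}_n(\mathcal M,\alpha)\ \ge\ \kappa\,\frac{1-8\lambda^2nL}{\lambda^4nL}\,C_\alpha .$$ In particular, there is $c>0$ (depending only on $C$) such that for every $D>0$ there is $\kappa'>0$ (depending only on $C,D$) such that, whenever $n\ge 1$ and $|\mathcal M|\le\exp(d^{D})$: if $0<\alpha<\frac12$ and $n\le c\sqrt d/\log(d\log|\mathcal M|/C_\alpha)$, then $$\mathrm{mem}_n(\mathcal M,\alpha)\ \ge\ \kappa'\,\frac{1-8\lambda^2n\log(dn/C_\alpha)}{\lambda^4n\log(dn/C_\alpha)}\,C_\alpha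 ,$$ and if $n\le c\sqrt d/\log(d\log|\mathcal M|/C_{1/3})$, then $\mathrm{mem}_n(\mathcal M,\tfrac13)\ge \kappa'\, \dfrac{d}{n\log d}$ (so it is $\widetilde\Omega(d/n)$). 3. If $1\le n\le\sqrt d$, then for some $t\in\mathbb N$ and $s\in\mathbb R$ the learner that outputs the classifier $x\mapsto\mathbf 1[\sum_{j\le \min(t,d)}\hat\theta_jx_j\ge s]$, where $\hat\theta$ is the coordinatewise majority vote of $X_{1:n}$ (ties broken towards $+1$), has error at most $0.01$ and $\mathrm{mem}_n\le K_1 d/n$. For every $n\ge1$, for some $s\in\mathbb R$ the same learner with $t=d$ has error at most $0.01$ and $\mathrm{mem}_n\le K_2\,d^2n\exp(-n/\sqrt d)$; moreover for every $k\in\mathbb N$ there is $B_k$ (depending only on $C$ and $k$) such that this memorization is at most $d^{-k}$ whenever $n\ge B_k\sqrt d\log d$. -/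

import Mathlib

namespace ExcessMem

noncomputable section

/-! Finitely supported probability. A distribution on a finite type `α` is an element of
`stdSimplex ℝ α`: a nonnegative real mass function with total mass one. -/

/-- The uniform distribution on a finite nonempty type. -/
def uniform (α : Type) [Fintype α] [Nonempty α] : stdSimplex ℝ α :=
  ⟨fun _ => 1 / (Fintype.card α : ℝ), fun _ => by positivity, by simp⟩

/-- The product of the distributions `p i`: the coordinates are independent. -/
def prodDist {ι κ : Type} [Fintype ι] [DecidableEq ι] [Fintype κ]
    (p : ι → stdSimplex ℝ κ) : stdSimplex ℝ (ι → κ) :=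
  ⟨fun y => ∏ i, p i (y i), fun y => Finset.prod_nonneg fun i _ => (p i).2.1 (y i), by
    rw [← Fintype.prod_sum (fun i k => p i k)]
    exact Finset.prod_eq_one fun i _ => (p i).2.2⟩

/-- The law of `A` when `B ∼ q` and, given `B = b`, `A ∼ k b`. -/
def mix {α β : Type} [Fintype α] [Fintype β]
    (q : stdSimplex ℝ β) (k : β → stdSimplex ℝ α) : stdSimplex ℝ α :=
  ⟨fun a => ∑ b, q b * k b a,
    fun a => Finset.sum_nonneg fun b _ => mul_nonneg (q.2.1 b) ((k b).2.1 a), by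
    rw [Finset.sum_comm]
    have h : ∀ b, ∑ a, q b * k b a = q b := fun b => by
      rw [← Finset.mul_sum, show ∑ a, k b a = 1 from (k b).2.2, mul_one]
    simp only [h]
    exact q.2.2⟩

/-- Shannon entropy, in nats. -/
def entropy {α : Type} [Fintype α] (p : stdSimplex ℝ α) : ℝ :=
  ∑ a, Real.negMulLog (p a)

/-- The mutual information `I(A; B) = H(A) - H(A | B)` of a pair with `B ∼ q` and, given
`B = b`, `A ∼ k b`. -/
def mutualInfo {α β : Type} [Fintype α] [Fintype β]
    (q : stdSimplex ℝ β) (k : β → stdSimplex ℝ α) : ℝ :=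
  entropy (mix q k) - ∑ b, q b * entropy (k b)

/-! Learning problems, learners, error and excess memorization. -/

/-- An average-case learning problem: a family `law θ` of distributions on `X` together with a
prior on the parameter `θ`. -/
structure LearningProblem (Θ X : Type) [Fintype Θ] [Fintype X] where
  prior : stdSimplex ℝ Θ
  law : Θ → stdSimplex ℝ X

/-- A (randomized) learner on `n` samples with model space `M`: given the data set it draws a model
in `M`, and every model `m` is used as the binary classifier `predict m`. -/
structure Learner (n : ℕ) (X M : Type) [Fintype M] where
  run : (Fin n → X) → stdSimplex ℝ M
  predict : M → X → Bool

section
variable {Θ X M : Type} [Fintype Θ] [Fintype X] [Fintype M]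

/-- The null distribution: the marginal of `x ∼ P_θ` for `θ` drawn from the prior. -/
def LearningProblem.null (P : LearningProblem Θ X) : stdSimplex ℝ X := mix P.prior P.law

/-- The classification error of `h` at parameter `θ`: with probability `1/2` the test point is drawn
from `P_θ` and has label `true`, otherwise from the null distribution with label `false`. -/
def LearningProblem.clsErr (P : LearningProblem Θ X) (θ : Θ) (h : X → Bool) : ℝ :=
  (1 / 2) * (∑ x, if h x = true then 0 else P.law θ x) +
    (1 / 2) * (∑ x, if h x = false then 0 else P.null x)

/-- The law of `n` independent samples from `P_θ`. -/
def LearningProblem.dataLaw (P : LearningProblem Θ X) (n : ℕ) (θ : Θ) :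
    stdSimplex ℝ (Fin n → X) :=
  prodDist fun _ => P.law θ

/-- The expected error over the parameter, the data set and the randomness of the learner. -/
def LearningProblem.err (P : LearningProblem Θ X) {n : ℕ} (A : Learner n X M) : ℝ :=
  ∑ θ, P.prior θ * ∑ S, P.dataLaw n θ S * ∑ m, A.run S m * P.clsErr θ (A.predict m)

/-- The excess memorization `E_θ [I(A(X_{1:n}); X_{1:n})]`, where `X_{1:n} ∼ P_θ^n` inside the
mutual information. -/
def LearningProblem.mem (P : LearningProblem Θ X) {n : ℕ} (A : Learner n X M) : ℝ :=
  ∑ θ, P.prior θ * mutualInfo (P.dataLaw n θ) A.run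

/-- The least memorization on `n` samples among the learners with model space `M` whose error is
at most `α` (it is `⊤` if there is none). -/
def LearningProblem.memInf (P : LearningProblem Θ X) (n : ℕ) (M : Type) [Fintype M] (α : ℝ) :
    EReal :=
  ⨅ (A : Learner n X M) (_ : P.err A ≤ α), ((P.mem A : ℝ) : EReal)

end

/-! Boolean clustering. -/

/-- The hypercube `{±1}^d`. -/
abbrev Cube (d : ℕ) : Type := Fin d → ℤˣ

/-- The law of a sign that differs from `x` with probability `p`. -/
def flipDist (p : Set.Icc (0 : ℝ) 1) (x : ℤˣ) : stdSimplex ℝ ℤˣ :=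
  ⟨fun y => if y ≠ x then p else 1 - p, fun y => by
    have h1 := p.2.1
    have h2 := p.2.2
    dsimp only
    split_ifs <;> linarith, by
    rcases Int.units_eq_one_or x with rfl | rfl <;> simp⟩

/-- The binary symmetric channel: every coordinate of `x` is flipped independently with
probability `p`. -/
def bsc {d : ℕ} (p : Set.Icc (0 : ℝ) 1) (x : Cube d) : stdSimplex ℝ (Cube d) :=
  prodDist fun i => flipDist p (x i)

/-- The crossover probability `(1 - lam) / 2`. -/
def crossover (lam : Set.Ioo (0 : ℝ) 1) : Set.Icc (0 : ℝ) 1 :=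
  ⟨(1 - lam) / 2, by have := lam.2.2; linarith, by have := lam.2.1; linarith⟩

/-- The Boolean clustering problem on `{±1}^d` with correlation `lam`. -/
def boolClustering (d : ℕ) (lam : Set.Ioo (0 : ℝ) 1) : LearningProblem (Cube d) (Cube d) where
  prior := uniform (Cube d)
  law := fun θ => bsc (crossover lam) θ

/-- The coordinatewise majority vote of the data (ties are broken towards `1`). -/
def majorityVote {n d : ℕ} (S : Fin n → Cube d) : Cube d :=
  fun j => if 0 ≤ ∑ i, (S i j : ℤ) then 1 else -1

/-- The linear classifier `x ↦ 1[⟨u, x⟩ ≥ s]` on the first `t` coordinates. -/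
def linearClassifier {d : ℕ} (t : ℕ) (s : ℝ) (u : Cube d) : Cube d → Bool :=
  fun x => decide (s ≤ ∑ j : Fin d, if (j : ℕ) < t then (((u j : ℤ) * (x j : ℤ) : ℤ) : ℝ) else 0)

/-- The deterministic learner that outputs the linear classifier on the first `t` coordinates with
threshold `s` whose direction is the majority vote. Its models are the classifiers themselves. -/
def majorityLearner (n d t : ℕ) (s : ℝ) : Learner n (Cube d) (Cube d → Bool) where
  run := fun S => ⟨Pi.single (linearClassifier t s (majorityVote S)) 1, single_mem_stdSimplex ℝ _⟩
  predict := id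

/-- `C_α = (1 - 2α) log ((1 - α) / α)`. -/
def cAlpha (α : ℝ) : ℝ := (1 - 2 * α) * Real.log ((1 - α) / α)

end

end ExcessMem

open ExcessMem

/-!
Lower bound. For each model `m`, the functions `S ↦ P(m | S)`, `θ ↦ P(m | θ)` and `x ↦ P(m | x)`
(`S` the data, `x` an independent test point) are successive conditional expectations, and the
informations `I(A; S)`, `I(A; θ)`, `I(A; x)` are the sums over `m` of the entropy functional
`entFun` of these functions. All three channels are `d`-fold products, and a contraction of the
entropy functional by a channel tensorizes (`entFun_pi_le`: chain rule plus convexity), so one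
coordinate suffices. There `entFun_sign_le` shows that a channel from `y` to a uniform sign
contracts by twice the subgaussian variance proxy of the posterior mean of the sign. For a single
noisy copy this is `lam²`. For `n ≤ lam⁻²` copies the posterior mean is `tanh (artanh lam * ∑
yᵢ)`, which is subgaussian with proxy `8 lam² n` (`sum_sampleMarginal_exp_tanh_le`); no truncation
is needed, hence no logarithmic loss. Therefore `I(A; θ) ≤ 16 lam² n I(A; S) = 16 lam² n (mem +
I(A; θ))` and `I(A; x) ≤ 2 lam² I(A; θ)`, while an accurate model has `C_α ≤ 64 I(A; x)` by the
Donsker–Varadhan inequality. This gives `mem ≥ (1 - 16 lam² n) C_α / (2048 lam⁴ n)`, which is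
stronger than the claimed bounds as soon as the logarithms in them are at least `2`
(`mem_lower_bound`). That they are follows from `C_α ≤ 64 log |M|` and `C_α ≤ 128 lam² d`, valid
for every accurate learner, and from `d ≥ C⁴`, which is forced by `lam < 1`.

Upper bound. When `θ` is averaged out, the products of the coordinates of the majority vote and of
a test point are independent signs, with mean `lam * voteCorr` under the cluster and `0` under the
null distribution, so a Chernoff bound with the threshold in the middle controls the error
(`err_majorityLearner_le`). The majority vote is the test with the largest correlation with the
sign; comparing it with `sin (s ∑ yᵢ)` gives `voteCorr ≥ min 1 (lam √n) / 8` (`le_voteCorr`). The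
learner is deterministic, so its memorization is the entropy of its output given `θ`. This is at
most `t log 2`, and also at most `2 d exp (-lam² n / 4)` since every coordinate of the vote is
wrong with probability at most `exp (-lam² n / 2)`.
-/

namespace ExcessMem
open Real

/-! ### The entropy functional and mutual information -/

/-- The entropy functional `Ent_p(f) = E_p[f log f] - E_p[f] log E_p[f]` of a nonnegative function
`f` under the weights `p`. -/
noncomputable def entFun {α : Type} [Fintype α] (p f : α → ℝ) : ℝ :=
  negMulLog (∑ a, p a * f a) - ∑ a, p a * negMulLog (f a)

section
variable {α β : Type} [Fintype α] [Fintype β]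

/-- The log-sum inequality. The condition `hz` is absolute continuity; it makes the junk value
`log 0 = 0` harmless. -/
theorem log_sum_inequality {p f h : α → ℝ} (hp : ∀ a, 0 ≤ p a) (hf : ∀ a, 0 ≤ f a)
    (hh : ∀ a, 0 ≤ h a) (hz : ∀ a, h a = 0 → p a * f a = 0) :
    ∑ a, p a * f a * log (h a) - (∑ a, p a * f a) * log (∑ a, p a * h a) ≤ entFun p f := by
  have hpf : ∀ a, 0 ≤ p a * f a := fun a => mul_nonneg (hp a) (hf a)
  have hph : ∀ a, 0 ≤ p a * h a := fun a => mul_nonneg (hp a) (hh a)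
  unfold entFun
  set F := ∑ a, p a * f a with hF
  set H := ∑ a, p a * h a with hH
  have hF0 : 0 ≤ F := Finset.sum_nonneg fun a _ => hpf a
  rcases hF0.eq_or_lt with h0 | hFpos
  · have hall : ∀ a, p a * f a = 0 := fun a =>
      (Finset.sum_eq_zero_iff_of_nonneg fun a _ => hpf a).1 (hF ▸ h0.symm) a (Finset.mem_univ a)
    rw [← h0]
    simp only [hall, zero_mul, Finset.sum_const_zero, negMulLog_zero, sub_zero, zero_sub]
    have : ∀ a, p a * negMulLog (f a) = 0 := fun a => by
      rw [negMulLog, neg_mul, mul_neg, ← mul_assoc, hall a, zero_mul, neg_zero]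
    simp [this]
  · obtain ⟨b, -, hb⟩ : ∃ b ∈ Finset.univ, p b * f b ≠ 0 :=
      Finset.exists_ne_zero_of_sum_ne_zero hFpos.ne'
    have hhb : h b ≠ 0 := fun h0 => hb (hz b h0)
    have hpb : p b ≠ 0 := left_ne_zero_of_mul hb
    have hHpos : 0 < H := by
      refine lt_of_lt_of_le ?_ (Finset.single_le_sum (fun a _ => hph a) (Finset.mem_univ b))
      exact mul_pos ((hp b).lt_of_ne' hpb) ((hh b).lt_of_ne' hhb)
    have key : ∀ a, p a * f a * log (h a) - p a * f a * log H + p a * f a * log F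
        + p a * negMulLog (f a) ≤ p a * h a * (F / H) - p a * f a := fun a => by
      by_cases h0 : p a * f a = 0
      · have : p a * negMulLog (f a) = 0 := by
          rw [negMulLog, neg_mul, mul_neg, ← mul_assoc, h0, zero_mul, neg_zero]
        rw [this, h0]
        have := mul_nonneg (hph a) (div_pos hFpos hHpos).le
        linarith
      · have ha : 0 < h a := (hh a).lt_of_ne' fun h1 => h0 (hz a h1)
        have hfa : 0 < f a := (hf a).lt_of_ne' (right_ne_zero_of_mul h0)
        have hl := log_le_sub_one_of_pos (x := h a * F / (H * f a)) (by positivity)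
        rw [log_div (by positivity) (by positivity), log_mul ha.ne' hFpos.ne',
          log_mul hHpos.ne' hfa.ne'] at hl
        have := mul_le_mul_of_nonneg_left hl (hpf a)
        have e : p a * f a * (h a * F / (H * f a) - 1) = p a * h a * (F / H) - p a * f a := by
          field_simp
        rw [e] at this
        rw [negMulLog]
        linarith
    have hs := Finset.sum_le_sum fun a (_ : a ∈ Finset.univ) => key a
    simp only [Finset.sum_add_distrib, Finset.sum_sub_distrib, ← Finset.sum_mul] at hs
    rw [← hF, ← hH, mul_div_cancel₀ _ hHpos.ne'] at hs
    rw [negMulLog]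
    linarith

/-- The Donsker–Varadhan variational bound. -/
theorem sum_mul_le_entFun_add {p f : α → ℝ} (hp : ∀ a, 0 ≤ p a) (hf : ∀ a, 0 ≤ f a)
    (ψ : α → ℝ) :
    ∑ a, p a * f a * ψ a ≤ entFun p f + (∑ a, p a * f a) * log (∑ a, p a * exp (ψ a)) := by
  have := log_sum_inequality (h := fun a => exp (ψ a)) hp hf (fun a => (exp_pos _).le)
    (fun a h => absurd h (exp_pos _).ne')
  simp only [log_exp] at this
  linarith

theorem entFun_nonneg {p f : α → ℝ} (hp : ∀ a, 0 ≤ p a) (hf : ∀ a, 0 ≤ f a)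
    (hp1 : ∑ a, p a = 1) : 0 ≤ entFun p f := by
  have := log_sum_inequality (h := fun _ => 1) hp hf (fun a => zero_le_one) (by simp)
  simpa [hp1] using this

/-- The entropy functional is convex and positively homogeneous. -/
theorem entFun_sum_le {p : α → ℝ} {c : β → ℝ} {f : β → α → ℝ} (hp : ∀ a, 0 ≤ p a)
    (hc : ∀ b, 0 ≤ c b) (hf : ∀ b a, 0 ≤ f b a) :
    entFun p (fun a => ∑ b, c b * f b a) ≤ ∑ b, c b * entFun p (f b) := by
  set h : α → ℝ := fun a => ∑ b, c b * f b a with hh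
  have hh0 : ∀ a, 0 ≤ h a := fun a => Finset.sum_nonneg fun b _ => mul_nonneg (hc b) (hf b a)
  have key : ∀ b, c b * (∑ a, p a * f b a * log (h a) -
      (∑ a, p a * f b a) * log (∑ a, p a * h a)) ≤ c b * entFun p (f b) := fun b => by
    rcases (hc b).eq_or_lt with h0 | hpos
    · simp [← h0]
    · refine mul_le_mul_of_nonneg_left (log_sum_inequality hp (hf b) hh0 fun a ha => ?_) (hc b)
      have := (Finset.sum_eq_zero_iff_of_nonneg fun b _ => mul_nonneg (hc b) (hf b a)).1 ha b
        (Finset.mem_univ b)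
      rw [(mul_eq_zero.1 this).resolve_left hpos.ne', mul_zero]
  refine le_trans (le_of_eq ?_) (Finset.sum_le_sum fun b _ => key b)
  have e1 : ∑ b, c b * ∑ a, p a * f b a * log (h a) = ∑ a, p a * (h a * log (h a)) := by
    simp only [Finset.mul_sum]
    rw [Finset.sum_comm]
    refine Finset.sum_congr rfl fun a _ => ?_
    rw [← mul_assoc, hh, Finset.mul_sum, Finset.sum_mul]
    exact Finset.sum_congr rfl fun b _ => by ring
  have e2 : ∑ b, c b * ∑ a, p a * f b a = ∑ a, p a * h a := by
    simp only [Finset.mul_sum, hh]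
    rw [Finset.sum_comm]
    exact Finset.sum_congr rfl fun a _ => Finset.sum_congr rfl fun b _ => by ring
  simp only [mul_sub, Finset.sum_sub_distrib, ← mul_assoc, ← Finset.sum_mul]
  simp only [mul_assoc] at e1 e2 ⊢
  rw [e1, e2]
  simp only [entFun, negMulLog, neg_mul, mul_neg, Finset.sum_neg_distrib]
  ring

/-- The chain rule for the entropy functional under a mixture of weights. -/
theorem entFun_mixture (q : β → ℝ) (k : β → α → ℝ) (f : α → ℝ) :
    entFun (fun a => ∑ b, q b * k b a) f =
      ∑ b, q b * entFun (k b) f + entFun q (fun b => ∑ a, k b a * f a) := by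
  have e : ∀ g : α → ℝ, ∑ a, (∑ b, q b * k b a) * g a = ∑ b, q b * ∑ a, k b a * g a := fun g => by
    simp only [Finset.sum_mul, Finset.mul_sum]
    rw [Finset.sum_comm]
    exact Finset.sum_congr rfl fun a _ => Finset.sum_congr rfl fun b _ => by ring
  simp only [entFun, e, mul_sub, Finset.sum_sub_distrib]
  ring

/-- The `χ²` bound on relative entropy. -/
theorem entFun_le_variance {p f : α → ℝ} (hp : ∀ a, 0 ≤ p a) (hf : ∀ a, 0 ≤ f a) {m : ℝ}
    (hp1 : ∑ a, p a = 1) (hm : 0 < m) (hmf : ∑ a, p a * f a = m) :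
    entFun p f ≤ (∑ a, p a * (f a - m) ^ 2) / m := by
  have key : ∀ a, -(p a * negMulLog (f a)) ≤ p a * f a * log m + (p a * (f a - m) ^ 2) / m
      + (p a * f a - p a * m) := fun a => by
    rcases (hf a).eq_or_lt with h0 | hpos
    · rw [← h0]; simp; rw [div_eq_mul_inv]; field_simp; simp
    · have hl := log_le_sub_one_of_pos (x := f a / m) (by positivity)
      rw [log_div hpos.ne' hm.ne'] at hl
      have := mul_le_mul_of_nonneg_left hl (mul_nonneg (hp a) (hf a))
      have e : p a * f a * (f a / m - 1) = (p a * (f a - m) ^ 2) / m + (p a * f a - p a * m) := by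
        field_simp; ring
      rw [negMulLog]
      linarith
  have hs := Finset.sum_le_sum fun a (_ : a ∈ Finset.univ) => key a
  simp only [Finset.sum_add_distrib, Finset.sum_sub_distrib, ← Finset.sum_mul,
    Finset.sum_neg_distrib, hmf, hp1, ← Finset.sum_div] at hs
  rw [entFun, hmf, negMulLog]
  linarith

/-- Mutual information as a sum of entropy functionals, one for every output value. -/
theorem mutualInfo_eq_sum_entFun (q : stdSimplex ℝ β) (k : β → stdSimplex ℝ α) :
    mutualInfo q k = ∑ a, entFun (fun b => q b) (fun b => k b a) := by
  simp only [mutualInfo, entropy, entFun, Finset.mul_sum, Finset.sum_sub_distrib]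
  rw [Finset.sum_comm (s := Finset.univ (α := β))]
  rfl

theorem mutualInfo_nonneg (q : stdSimplex ℝ β) (k : β → stdSimplex ℝ α) :
    0 ≤ mutualInfo q k := by
  rw [mutualInfo_eq_sum_entFun]
  exact Finset.sum_nonneg fun a _ => entFun_nonneg q.2.1 (fun b => (k b).2.1 a) q.2.2

/-- Gibbs' inequality: the entropy is at most the cross entropy with respect to any
subdistribution `r`. -/
theorem entropy_le_cross (p : stdSimplex ℝ α) {r : α → ℝ} (hr : ∀ a, 0 ≤ r a)
    (hr1 : ∑ a, r a ≤ 1) (hz : ∀ a, r a = 0 → p a = 0) :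
    entropy p ≤ ∑ a, p a * (-log (r a)) := by
  have h := log_sum_inequality (p := fun _ => 1) (f := fun a => p a) (h := r)
    (fun a => zero_le_one) p.2.1 hr (by simpa using hz)
  have h1 : ∑ a, p a = 1 := p.2.2
  simp only [one_mul, entFun, h1, negMulLog_one] at h
  have h2 : log (∑ a, r a) ≤ 0 := log_nonpos (Finset.sum_nonneg fun a _ => hr a) hr1
  simp only [entropy, mul_neg, Finset.sum_neg_distrib]
  linarith

theorem entropy_nonneg (p : stdSimplex ℝ α) : 0 ≤ entropy p := by
  refine Finset.sum_nonneg fun a _ => negMulLog_nonneg (p.2.1 a) ?_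
  have h1 : ∑ a, p a = 1 := p.2.2
  rw [← h1]
  exact Finset.single_le_sum (fun b _ => p.2.1 b) (Finset.mem_univ a)

theorem entropy_le_log_card [Nonempty α] (p : stdSimplex ℝ α) :
    entropy p ≤ log (Fintype.card α) := by
  have hc : (0 : ℝ) < Fintype.card α := by exact_mod_cast Fintype.card_pos
  have := entropy_le_cross p (r := fun _ => 1 / (Fintype.card α : ℝ)) (fun a => by positivity)
    (by simp) (fun a h => absurd h (by positivity))
  refine this.trans (le_of_eq ?_)
  have h1 : ∑ a, p a = 1 := p.2.2
  rw [← Finset.sum_mul, h1]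
  simp

theorem mutualInfo_le_log_card [Nonempty α] (q : stdSimplex ℝ β) (k : β → stdSimplex ℝ α) :
    mutualInfo q k ≤ log (Fintype.card α) := by
  have h1 := entropy_le_log_card (mix q k)
  have h2 : 0 ≤ ∑ b, q b * entropy (k b) :=
    Finset.sum_nonneg fun b _ => mul_nonneg (q.2.1 b) (entropy_nonneg _)
  unfold mutualInfo
  linarith

theorem mutualInfo_uniform_le_log_card [Nonempty β] (k : β → stdSimplex ℝ α) :
    mutualInfo (uniform β) k ≤ log (Fintype.card β) := by
  have hc : (0 : ℝ) < Fintype.card β := by exact_mod_cast Fintype.card_pos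
  set N : ℝ := (Fintype.card β : ℝ)
  have hu : ∀ b, uniform β b = 1 / N := fun b => rfl
  rw [mutualInfo_eq_sum_entFun]
  have key : ∀ a, entFun (fun b => uniform β b) (fun b => k b a) ≤
      (∑ b, uniform β b * k b a) * log N := fun a => by
    set Q := ∑ b, uniform β b * k b a with hQ
    have h0 : ∀ b, 0 ≤ uniform β b * k b a := fun b => mul_nonneg ((uniform β).2.1 b) ((k b).2.1 a)
    have : ∀ b, -(uniform β b * negMulLog (k b a)) ≤ uniform β b * k b a * (log N + log Q) := by
      intro b
      rcases ((k b).2.1 a).eq_or_lt with hk | hk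
      · have hk : k b a = 0 := hk.symm
        simp [hk]
      · have hk : 0 < k b a := hk
        have hle : uniform β b * k b a ≤ Q :=
          Finset.single_le_sum (fun b _ => h0 b) (Finset.mem_univ b)
        have hpos : 0 < uniform β b * k b a := by rw [hu]; positivity
        have : k b a ≤ N * Q := by
          rw [hu] at hle
          calc k b a = N * (1 / N * k b a) := by field_simp
            _ ≤ _ := by gcongr
        have hl := log_le_log hk this
        rw [log_mul hc.ne' (hpos.trans_le hle).ne'] at hl
        have := mul_le_mul_of_nonneg_left hl hpos.le
        rw [negMulLog]
        linarith
    have hs := Finset.sum_le_sum fun b (_ : b ∈ Finset.univ) => this b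
    rw [← Finset.sum_mul, ← hQ, Finset.sum_neg_distrib] at hs
    rw [entFun, ← hQ, negMulLog]
    linarith
  refine (Finset.sum_le_sum fun a _ => key a).trans (le_of_eq ?_)
  rw [← Finset.sum_mul]
  have : ∑ a, ∑ b, uniform β b * k b a = 1 := (mix (uniform β) k).2.2
  rw [this, one_mul]

end

/-! ### Tensorization of strong data processing inequalities -/

theorem sum_fin_cons {κ : Type} [Fintype κ] {d : ℕ} (F : (Fin (d + 1) → κ) → ℝ) :
    ∑ y, F y = ∑ a, ∑ z : Fin d → κ, F (Fin.cons a z) := by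
  rw [← (Fin.consEquiv fun _ => κ).sum_comp, Fintype.sum_prod_type]
  rfl

/-- The chain rule for the entropy functional under product weights on `Fin (d + 1) → κ`. -/
theorem entFun_fin_cons {κ : Type} [Fintype κ] {d : ℕ} (μ : κ → ℝ) (g : (Fin (d + 1) → κ) → ℝ) :
    entFun (fun y => ∏ j, μ (y j)) g =
      ∑ a, μ a * entFun (fun z : Fin d → κ => ∏ j, μ (z j)) (fun z => g (Fin.cons a z)) +
        entFun μ (fun a => ∑ z : Fin d → κ, (∏ j, μ (z j)) * g (Fin.cons a z)) := by
  simp only [entFun, sum_fin_cons, Fin.prod_univ_succ, Fin.cons_zero, Fin.cons_succ, mul_sub,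
    Finset.sum_sub_distrib, mul_assoc, Finset.mul_sum]
  ring

/-- A strong data processing inequality tensorizes: if averaging against the kernel `k`, which maps
functions on `κ` to functions on `ι`, contracts the entropy functional by `η`, then so does
averaging against its `d`-fold product. Here `μ` is the image of the weights `q` on `ι` under `k`. -/
theorem entFun_pi_le {ι κ : Type} [Fintype ι] [Fintype κ] {q : ι → ℝ} {k : ι → κ → ℝ}
    {μ : κ → ℝ} {η : ℝ} (hq : ∀ x, 0 ≤ q x) (hk : ∀ x y, 0 ≤ k x y)
    (hμ : ∀ y, ∑ x, q x * k x y = μ y) (hη : 0 ≤ η)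
    (H : ∀ g : κ → ℝ, (∀ y, 0 ≤ g y) → entFun q (fun x => ∑ y, k x y * g y) ≤ η * entFun μ g)
    (d : ℕ) (g : (Fin d → κ) → ℝ) (hg : ∀ y, 0 ≤ g y) :
    entFun (fun x : Fin d → ι => ∏ j, q (x j)) (fun x => ∑ y, (∏ j, k (x j) (y j)) * g y) ≤
      η * entFun (fun y => ∏ j, μ (y j)) g := by
  have hμ0 : ∀ y, 0 ≤ μ y := fun y => by
    rw [← hμ]; exact Finset.sum_nonneg fun x _ => mul_nonneg (hq x) (hk x y)
  induction d with
  | zero => simp [entFun]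
  | succ d ih =>
    rw [entFun_fin_cons, entFun_fin_cons, mul_add]
    refine add_le_add ?_ ?_
    · -- the last `d` coordinates: induction, then convexity to average over the first one
      have h1 : ∀ x, entFun (fun z : Fin d → ι => ∏ j, q (z j))
          (fun z => ∑ y : Fin (d + 1) → κ,
            (∏ j, k ((Fin.cons x z : Fin (d + 1) → ι) j) (y j)) * g y)
          ≤ η * ∑ a, k x a * entFun (fun z : Fin d → κ => ∏ j, μ (z j))
            (fun z => g (Fin.cons a z)) := fun x => by
        have e : ∀ z : Fin d → ι, ∑ y : Fin (d + 1) → κ,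
            (∏ j, k ((Fin.cons x z : Fin (d + 1) → ι) j) (y j)) * g y =
            ∑ y : Fin d → κ, (∏ j, k (z j) (y j)) * ∑ a, k x a * g (Fin.cons a y) := fun z => by
          rw [sum_fin_cons, Finset.sum_comm]
          simp only [Fin.prod_univ_succ, Fin.cons_zero, Fin.cons_succ, Finset.mul_sum]
          exact Finset.sum_congr rfl fun _ _ => Finset.sum_congr rfl fun _ _ => by ring
        simp only [e]
        refine (ih (fun y => ∑ a, k x a * g (Fin.cons a y)) fun y =>
          Finset.sum_nonneg fun a _ => mul_nonneg (hk x a) (hg _)).trans ?_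
        refine mul_le_mul_of_nonneg_left ?_ hη
        exact entFun_sum_le (fun y => Finset.prod_nonneg fun j _ => hμ0 _) (hk x)
          fun a y => hg _
      refine (Finset.sum_le_sum fun x _ => mul_le_mul_of_nonneg_left (h1 x) (hq x)).trans
        (le_of_eq ?_)
      simp only [← hμ, Finset.sum_mul, Finset.mul_sum]
      rw [Finset.sum_comm]
      exact Finset.sum_congr rfl fun _ _ => Finset.sum_congr rfl fun _ _ => by ring
    · -- the first coordinate: averaging over the others commutes with the channel
      have e : ∀ x, ∑ z : Fin d → ι, (∏ j, q (z j)) * ∑ y : Fin (d + 1) → κ,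
            (∏ j, k ((Fin.cons x z : Fin (d + 1) → ι) j) (y j)) * g y =
          ∑ a, k x a * ∑ z : Fin d → κ, (∏ j, μ (z j)) * g (Fin.cons a z) := fun x => by
        have e1 : ∀ y : Fin d → κ, ∏ j, μ (y j) =
            ∑ z : Fin d → ι, ∏ j, q (z j) * k (z j) (y j) := fun y => by
          rw [← Fintype.prod_sum (fun j i => q i * k i (y j))]
          exact Finset.prod_congr rfl fun j _ => (hμ _).symm
        simp only [sum_fin_cons, Fin.prod_univ_succ, Fin.cons_zero, Fin.cons_succ, e1,
          Finset.mul_sum, Finset.sum_mul, Finset.prod_mul_distrib]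
        rw [Finset.sum_comm]
        refine Finset.sum_congr rfl fun a _ => ?_
        rw [Finset.sum_comm]
        exact Finset.sum_congr rfl fun _ _ => Finset.sum_congr rfl fun _ _ => by ring
      simp only [e]
      exact H _ fun a => Finset.sum_nonneg fun z _ =>
        mul_nonneg (Finset.prod_nonneg fun j _ => hμ0 _) (hg _)

theorem sum_units_int (f : ℤˣ → ℝ) : ∑ x, f x = f 1 + f (-1) := by
  rw [show (Finset.univ : Finset ℤˣ) = {1, -1} from rfl, Finset.sum_pair (by decide)]

/-- A strong data processing inequality for a channel from a uniform sign. If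
`w y = E[sign | y]` is subgaussian with variance proxy `v` under the output law `μ`, then the
posterior mean of the sign contracts the entropy functional by `2 v`: the entropy of the two-point
function is at most its variance `δ² / m`, where `δ = E[g w]` and `m = E[g]`, and `δ²` is bounded
by the Donsker–Varadhan inequality. -/
theorem entFun_sign_le {κ : Type} [Fintype κ] {k : ℤˣ → κ → ℝ} {μ w : κ → ℝ} {v : ℝ}
    (hμ0 : ∀ y, 0 ≤ μ y) (hk : ∀ (x : ℤˣ) y, k x y = μ y * (1 + ((x : ℤ) : ℝ) * w y)) (hv : 0 < v)
    (hw : ∀ t : ℝ, ∑ y, μ y * exp (t * w y) ≤ exp (v * t ^ 2 / 2))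
    (g : κ → ℝ) (hg : ∀ y, 0 ≤ g y) (hk0 : ∀ x y, 0 ≤ k x y) :
    entFun (fun _ : ℤˣ => (1 / 2 : ℝ)) (fun x => ∑ y, k x y * g y) ≤ 2 * v * entFun μ g := by
  set m := ∑ y, μ y * g y with hm
  set δ := ∑ y, μ y * g y * w y with hδ
  have hK : ∀ x : ℤˣ, ∑ y, k x y * g y = m + ((x : ℤ) : ℝ) * δ := fun x => by
    rw [hm, hδ, Finset.mul_sum, ← Finset.sum_add_distrib]
    exact Finset.sum_congr rfl fun y _ => by rw [hk]; ring
  have hK0 : ∀ x : ℤˣ, 0 ≤ ∑ y, k x y * g y := fun x =>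
    Finset.sum_nonneg fun y _ => mul_nonneg (hk0 x y) (hg y)
  have hm0 : 0 ≤ m := Finset.sum_nonneg fun y _ => mul_nonneg (hμ0 y) (hg y)
  rcases hm0.eq_or_lt with h0 | hmpos
  · have hall : ∀ y, μ y * g y = 0 := fun y =>
      (Finset.sum_eq_zero_iff_of_nonneg fun y _ => mul_nonneg (hμ0 y) (hg y)).1 (hm ▸ h0.symm) y
        (Finset.mem_univ y)
    have hδ0 : δ = 0 := by simp [hδ, hall]
    have e1 : ∀ y, μ y * negMulLog (g y) = 0 := fun y => by
      rw [negMulLog, neg_mul, mul_neg, ← mul_assoc, hall y, zero_mul, neg_zero]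
    simp only [hK, hδ0, ← h0]
    simp [entFun, ← hm, ← h0, e1]
  · have hvar : entFun (fun _ : ℤˣ => (1 / 2 : ℝ)) (fun x => ∑ y, k x y * g y) ≤ δ ^ 2 / m := by
      refine (entFun_le_variance (m := m) (fun _ => by norm_num) hK0 ?_ hmpos ?_).trans
        (le_of_eq ?_)
      · rw [sum_units_int]; norm_num
      · rw [sum_units_int, hK, hK]; push_cast; ring
      · rw [sum_units_int, hK, hK]; push_cast; ring
    -- `t = δ / (v * m)` optimizes the bound `t * δ ≤ entFun μ g + m * (v * t ^ 2 / 2)`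
    have hDV := sum_mul_le_entFun_add hμ0 hg (fun y => δ / (v * m) * w y)
    have e1 : ∑ y, μ y * g y * (δ / (v * m) * w y) = δ / (v * m) * δ := by
      conv_rhs => rw [hδ, Finset.mul_sum]
      exact Finset.sum_congr rfl fun y _ => by ring
    have hpos : 0 < ∑ y, μ y * exp (δ / (v * m) * w y) := by
      obtain ⟨b, -, hb⟩ : ∃ b ∈ Finset.univ, μ b * g b ≠ 0 :=
        Finset.exists_ne_zero_of_sum_ne_zero hmpos.ne'
      refine lt_of_lt_of_le (mul_pos ((hμ0 b).lt_of_ne' (left_ne_zero_of_mul hb)) (exp_pos _))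
        (Finset.single_le_sum (f := fun y => μ y * exp (δ / (v * m) * w y))
          (fun y _ => mul_nonneg (hμ0 y) (exp_pos _).le) (Finset.mem_univ b))
    have hlog := (log_le_log hpos (hw (δ / (v * m))))
    rw [log_exp] at hlog
    rw [e1, ← hm] at hDV
    have h3 := mul_le_mul_of_nonneg_left hlog hm0
    have e2 : δ / (v * m) * δ - m * (v * (δ / (v * m)) ^ 2 / 2) = δ ^ 2 / m / (2 * v) := by
      field_simp; ring
    have h4 : δ ^ 2 / m / (2 * v) ≤ entFun μ g := by linarith
    rw [div_le_iff₀ (by positivity)] at h4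
    linarith

/-! ### Noisy copies of a sign -/

theorem flipDist_crossover (lam : Set.Ioo (0 : ℝ) 1) (x y : ℤˣ) :
    flipDist (crossover lam) x y = (1 + lam * ((x : ℤ) : ℝ) * ((y : ℤ) : ℝ)) / 2 := by
  change (if y ≠ x then (1 - (lam : ℝ)) / 2 else 1 - (1 - (lam : ℝ)) / 2) = _
  rcases Int.units_eq_one_or x with rfl | rfl <;> rcases Int.units_eq_one_or y with rfl | rfl <;>
    simp <;> ring

theorem flipDist_comm (lam : Set.Ioo (0 : ℝ) 1) (x y : ℤˣ) :
    flipDist (crossover lam) x y = flipDist (crossover lam) y x := by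
  rw [flipDist_crossover, flipDist_crossover]; ring

/-- The law of `n` independent noisy copies of the sign `x`. -/
noncomputable def sampleLaw (lam : Set.Ioo (0 : ℝ) 1) (n : ℕ) (x : ℤˣ) :
    stdSimplex ℝ (Fin n → ℤˣ) :=
  prodDist fun _ => flipDist (crossover lam) x

/-- The sum of `n` signs. -/
def signSum {n : ℕ} (y : Fin n → ℤˣ) : ℝ := ∑ i, ((y i : ℤ) : ℝ)

theorem signSum_neg {n : ℕ} (y : Fin n → ℤˣ) : signSum (-y) = -signSum y := by
  simp [signSum]

section
variable (lam : Set.Ioo (0 : ℝ) 1)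

theorem artanh_eq_log_sub_log : artanh lam = (log (1 + lam) - log (1 - lam)) / 2 := by
  have h0 := lam.2.1
  have h1 := lam.2.2
  rw [artanh_eq_half_log ⟨by linarith, h1.le⟩, log_div (by linarith) (by linarith)]
  ring

theorem artanh_le_two_mul (h : (lam : ℝ) ≤ 1 / 2) : artanh lam ≤ 2 * lam := by
  have h0 := lam.2.1
  have h1 := log_le_sub_one_of_pos (x := 1 + (lam : ℝ)) (by linarith)
  have h2 := one_sub_inv_le_log_of_pos (x := 1 - (lam : ℝ)) (by linarith)
  have h3 : (1 - (lam : ℝ))⁻¹ ≤ 1 + 2 * lam := by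
    rw [inv_le_iff_one_le_mul₀ (by linarith)]
    nlinarith
  rw [artanh_eq_log_sub_log]
  linarith

theorem flipDist_eq_exp (x y : ℤˣ) :
    flipDist (crossover lam) x y = 1 / 2 * exp ((log (1 + lam) + log (1 - lam)) / 2 +
      ((x : ℤ) : ℝ) * artanh lam * ((y : ℤ) : ℝ)) := by
  have h0 := lam.2.1
  have h1 := lam.2.2
  have e1 : exp (log (1 + (lam : ℝ))) = 1 + lam := exp_log (by linarith)
  have e2 : exp (log (1 - (lam : ℝ))) = 1 - lam := exp_log (by linarith)
  have a1 : (log (1 + (lam : ℝ)) + log (1 - lam)) / 2 + artanh lam = log (1 + lam) := by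
    rw [artanh_eq_log_sub_log]; ring
  have a2 : (log (1 + (lam : ℝ)) + log (1 - lam)) / 2 - artanh lam = log (1 - lam) := by
    rw [artanh_eq_log_sub_log]; ring
  rw [flipDist_crossover]
  rcases Int.units_eq_one_or x with rfl | rfl <;> rcases Int.units_eq_one_or y with rfl | rfl <;>
    simp [a1, a2, e1, e2, ← sub_eq_add_neg] <;> ring

/-- The sample law depends on the data only through their sum, by an exponential tilt. -/
theorem sampleLaw_eq_exp (n : ℕ) (x : ℤˣ) (y : Fin n → ℤˣ) :
    sampleLaw lam n x y = (1 / 2) ^ n * exp (n * ((log (1 + lam) + log (1 - lam)) / 2)) *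
      exp (((x : ℤ) : ℝ) * (artanh lam * signSum y)) := by
  change ∏ i, flipDist (crossover lam) x (y i) = _
  simp only [flipDist_eq_exp, Finset.prod_mul_distrib, ← exp_sum, Finset.sum_add_distrib]
  rw [Finset.prod_const, Finset.sum_const, ← Finset.mul_sum, Finset.card_univ, Fintype.card_fin,
    nsmul_eq_mul, exp_add, mul_assoc, signSum, mul_assoc]

theorem sampleLaw_neg (n : ℕ) (x : ℤˣ) (y : Fin n → ℤˣ) :
    sampleLaw lam n x (-y) = sampleLaw lam n (-x) y := by
  rw [sampleLaw_eq_exp, sampleLaw_eq_exp, signSum_neg]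
  push_cast
  ring_nf

/-- The marginal law of `n` noisy copies of a uniform sign. -/
noncomputable def sampleMarginal (n : ℕ) (y : Fin n → ℤˣ) : ℝ :=
  ∑ x : ℤˣ, 1 / 2 * sampleLaw lam n x y

theorem sampleMarginal_nonneg (n : ℕ) (y : Fin n → ℤˣ) : 0 ≤ sampleMarginal lam n y :=
  Finset.sum_nonneg fun x _ => mul_nonneg (by norm_num) ((sampleLaw lam n x).2.1 y)

theorem sampleMarginal_neg (n : ℕ) (y : Fin n → ℤˣ) :
    sampleMarginal lam n (-y) = sampleMarginal lam n y := by
  simp only [sampleMarginal, sum_units_int, sampleLaw_neg, neg_neg]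
  ring

/-- The posterior mean of the sign is `tanh (artanh lam * signSum y)`. -/
theorem sampleLaw_eq_marginal_mul (n : ℕ) (x : ℤˣ) (y : Fin n → ℤˣ) :
    sampleLaw lam n x y =
      sampleMarginal lam n y * (1 + ((x : ℤ) : ℝ) * tanh (artanh lam * signSum y)) := by
  have hc := (cosh_pos (artanh lam * signSum y)).ne'
  simp only [sampleMarginal, sum_units_int, sampleLaw_eq_exp]
  rw [tanh_eq_sinh_div_cosh, cosh_eq] at *
  rw [sinh_eq]
  rcases Int.units_eq_one_or x with rfl | rfl <;> simp <;> field_simp <;> ring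

theorem sum_sampleLaw_mul_exp (n : ℕ) (x : ℤˣ) (s : ℝ) :
    ∑ y, sampleLaw lam n x y * exp (s * signSum y) =
      (cosh s + lam * ((x : ℤ) : ℝ) * sinh s) ^ n := by
  have e : ∀ y : Fin n → ℤˣ, sampleLaw lam n x y * exp (s * signSum y) =
      ∏ i, flipDist (crossover lam) x (y i) * exp (s * ((y i : ℤ) : ℝ)) := fun y => by
    rw [signSum, Finset.mul_sum, exp_sum, Finset.prod_mul_distrib]
    rfl
  simp only [e]
  rw [← Fintype.prod_sum (fun _ z => flipDist (crossover lam) x z * exp (s * ((z : ℤ) : ℝ)))]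
  rw [Finset.prod_const, Finset.card_univ, Fintype.card_fin, sum_units_int, flipDist_crossover,
    flipDist_crossover, cosh_eq, sinh_eq]
  congr 1
  push_cast
  ring_nf

theorem abs_tanh_le (x : ℝ) : |tanh x| ≤ |x| := by
  wlog h : 0 ≤ x
  · have := this (-x) (by linarith)
    rwa [tanh_neg, abs_neg, abs_neg] at this
  rw [tanh_eq_sinh_div_cosh, abs_div, abs_of_nonneg (sinh_nonneg_iff.2 h), abs_of_nonneg h,
    abs_of_pos (cosh_pos x), div_le_iff₀ (cosh_pos x)]
  have hmono : MonotoneOn (fun x : ℝ => x * cosh x - sinh x) (Set.Ici 0) := by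
    refine monotoneOn_of_deriv_nonneg (convex_Ici 0) (by fun_prop) (by fun_prop) fun y hy => ?_
    rw [interior_Ici] at hy
    have : HasDerivAt (fun x : ℝ => x * cosh x - sinh x) (1 * cosh y + y * sinh y - cosh y) y :=
      ((hasDerivAt_id y).mul (hasDerivAt_cosh y)).sub (hasDerivAt_sinh y)
    rw [this.deriv]
    have := mul_nonneg hy.le (sinh_nonneg_iff.2 hy.le)
    linarith
  have := hmono (Set.mem_Ici.2 le_rfl) (Set.mem_Ici.2 h) h
  simp at this
  exact this

theorem cosh_add_mul_sinh_le {c s : ℝ} (hc : |c| ≤ 1) :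
    0 ≤ cosh s + c * sinh s ∧ cosh s + c * sinh s ≤ exp (s ^ 2 / 2 + c * tanh s) := by
  have h := abs_le.1 hc
  constructor
  · rw [cosh_eq, sinh_eq]
    nlinarith [exp_pos s, exp_pos (-s)]
  · have h1 : cosh s + c * sinh s = cosh s * (1 + c * tanh s) := by
      rw [tanh_eq_sinh_div_cosh]; field_simp
    rw [h1, exp_add]
    have h2 := add_one_le_exp (c * tanh s)
    calc cosh s * (1 + c * tanh s) ≤ cosh s * exp (c * tanh s) := by
          gcongr; linarith
      _ ≤ _ := by gcongr; exact cosh_le_exp_half_sq s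

/-- The posterior mean of a uniform sign given `n ≤ lam⁻²` noisy copies is subgaussian with variance
proxy of order `lam² n`. -/
theorem sum_sampleMarginal_exp_tanh_le {n : ℕ} (hn : n * (lam : ℝ) ^ 2 ≤ 1)
    (hl : (lam : ℝ) ≤ 1 / 2) (t : ℝ) :
    ∑ y, sampleMarginal lam n y * exp (t * tanh (artanh lam * signSum y)) ≤
      exp (8 * lam ^ 2 * n * t ^ 2 / 2) := by
  have h0 := lam.2.1
  set a := artanh lam with ha
  set s := t * a with hs
  have hneg : ∀ F : (Fin n → ℤˣ) → ℝ, ∑ y, F (-y) = ∑ y, F y := fun F =>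
    Equiv.sum_comp (Equiv.neg (Fin n → ℤˣ)) F
  have hsym : ∑ y, sampleMarginal lam n y * exp (t * tanh (a * signSum y)) =
      ∑ y, sampleMarginal lam n y * cosh (t * tanh (a * signSum y)) := by
    have h1 := hneg fun y => sampleMarginal lam n y * exp (t * tanh (a * signSum y))
    simp only [sampleMarginal_neg, signSum_neg, mul_neg, tanh_neg] at h1
    simp only [cosh_eq, mul_div_assoc', mul_add, ← Finset.sum_div, Finset.sum_add_distrib]
    linarith
  have hle : ∑ y, sampleMarginal lam n y * cosh (t * tanh (a * signSum y)) ≤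
      ∑ y, sampleMarginal lam n y * cosh (s * signSum y) := by
    refine Finset.sum_le_sum fun y _ => mul_le_mul_of_nonneg_left ?_ (sampleMarginal_nonneg _ _ _)
    rw [cosh_le_cosh, hs, mul_assoc, abs_mul, abs_mul t]
    exact mul_le_mul_of_nonneg_left (abs_tanh_le _) (abs_nonneg _)
  have hcosh : ∑ y, sampleMarginal lam n y * cosh (s * signSum y) =
      ((cosh s + lam * sinh s) ^ n + (cosh s + -lam * sinh s) ^ n) / 2 := by
    have h1 := sum_sampleLaw_mul_exp lam n 1 s
    have h2 := sum_sampleLaw_mul_exp lam n (-1) s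
    have h3 := sum_sampleLaw_mul_exp lam n 1 (-s)
    have h4 := sum_sampleLaw_mul_exp lam n (-1) (-s)
    simp only [cosh_neg, sinh_neg] at h3 h4
    push_cast at h1 h2 h3 h4
    simp only [mul_one, mul_neg, neg_mul, neg_neg] at h1 h2 h3 h4 ⊢
    simp only [sampleMarginal, sum_units_int, cosh_eq (_ * _)]
    have e : ∀ y : Fin n → ℤˣ, (1 / 2 * sampleLaw lam n 1 y + 1 / 2 * sampleLaw lam n (-1) y) *
        ((exp (s * signSum y) + exp (-(s * signSum y))) / 2) =
        (sampleLaw lam n 1 y * exp (s * signSum y) + sampleLaw lam n (-1) y * exp (s * signSum y)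
        + sampleLaw lam n 1 y * exp (-(s * signSum y))
        + sampleLaw lam n (-1) y * exp (-(s * signSum y))) / 4 := fun y => by ring
    simp only [e, ← Finset.sum_div, Finset.sum_add_distrib, h1, h2, h3, h4]
    ring
  rw [hsym]
  refine hle.trans ?_
  rw [hcosh]
  have hb1 := cosh_add_mul_sinh_le (c := lam) (s := s) (abs_le.2 ⟨by linarith, by linarith⟩)
  have hb2 := cosh_add_mul_sinh_le (c := -lam) (s := s) (abs_le.2 ⟨by linarith, by linarith⟩)
  have p1 := pow_le_pow_left₀ hb1.1 hb1.2 n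
  have p2 := pow_le_pow_left₀ hb2.1 hb2.2 n
  rw [← exp_nat_mul] at p1 p2
  have hT : tanh s ^ 2 ≤ s ^ 2 := sq_le_sq.2 (abs_tanh_le s)
  have ha2 : a ^ 2 ≤ 4 * lam ^ 2 := by
    have h1 := artanh_le_two_mul lam hl
    have h2 := (artanh_pos lam.2).le
    nlinarith
  calc ((cosh s + lam * sinh s) ^ n + (cosh s + -lam * sinh s) ^ n) / 2
      ≤ (exp (n * (s ^ 2 / 2 + lam * tanh s)) + exp (n * (s ^ 2 / 2 + -lam * tanh s))) / 2 := by
        linarith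
    _ = exp (n * (s ^ 2 / 2)) * cosh (n * (lam : ℝ) * tanh s) := by
        rw [cosh_eq, mul_div_assoc', mul_add (exp _), ← exp_add, ← exp_add]
        ring_nf
    _ ≤ exp (n * (s ^ 2 / 2)) * exp ((n * (lam : ℝ) * tanh s) ^ 2 / 2) := by
        gcongr; exact cosh_le_exp_half_sq _
    _ ≤ exp (8 * lam ^ 2 * n * t ^ 2 / 2) := by
        rw [← exp_add, exp_le_exp]
        have hn0 : (0 : ℝ) ≤ n := n.cast_nonneg
        have q1 : (n * (lam : ℝ) * tanh s) ^ 2 ≤ n * s ^ 2 := by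
          calc (n * (lam : ℝ) * tanh s) ^ 2 = (n * (lam : ℝ) ^ 2) * (n * tanh s ^ 2) := by ring
            _ ≤ 1 * (n * s ^ 2) := by gcongr
            _ = _ := one_mul _
        have q2 : n * s ^ 2 ≤ n * (t ^ 2 * (4 * lam ^ 2)) := by
          rw [hs, mul_pow]; gcongr
        nlinarith

/-- The strong data processing inequality for recovering a uniform sign from `n ≤ lam⁻²` noisy
copies. -/
theorem entFun_sampleLaw_le {n : ℕ} (hn1 : 1 ≤ n) (hn : n * (lam : ℝ) ^ 2 ≤ 1)
    (hl : (lam : ℝ) ≤ 1 / 2) (g : (Fin n → ℤˣ) → ℝ) (hg : ∀ y, 0 ≤ g y) :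
    entFun (fun _ : ℤˣ => (1 / 2 : ℝ)) (fun x => ∑ y, sampleLaw lam n x y * g y) ≤
      16 * lam ^ 2 * n * entFun (sampleMarginal lam n) g := by
  have h0 := lam.2.1
  have hn0 : (0 : ℝ) < n := by exact_mod_cast hn1
  refine (entFun_sign_le (k := fun x y => sampleLaw lam n x y) (v := 8 * lam ^ 2 * n)
    (sampleMarginal_nonneg lam n)
    (sampleLaw_eq_marginal_mul lam n) (by positivity) (fun t => ?_) g hg
    (fun x y => (sampleLaw lam n x).2.1 y)).trans (le_of_eq (by ring))
  exact sum_sampleMarginal_exp_tanh_le lam hn hl t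

/-- For a single copy the posterior mean of the sign is `lam * y`, which has variance proxy `lam²`. -/
theorem entFun_flipDist_le (g : ℤˣ → ℝ) (hg : ∀ y, 0 ≤ g y) :
    entFun (fun _ : ℤˣ => (1 / 2 : ℝ)) (fun x => ∑ y, flipDist (crossover lam) x y * g y) ≤
      2 * lam ^ 2 * entFun (fun _ : ℤˣ => (1 / 2 : ℝ)) g := by
  have h0 := lam.2.1
  refine entFun_sign_le (k := fun x y => flipDist (crossover lam) x y) (w := fun y => lam * y)
    (fun _ => by norm_num) (fun x y => ?_) (by positivity) (fun t => ?_) g hg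
    (fun x y => (flipDist _ x).2.1 y)
  · rw [flipDist_crossover]; ring
  · rw [sum_units_int]
    refine le_trans (le_of_eq ?_) ((cosh_le_exp_half_sq (t * lam)).trans (le_of_eq ?_))
    · rw [cosh_eq]; push_cast; ring_nf
    · ring_nf
end

/-! ### The memorization lower bound -/

theorem entFun_comp_equiv {α β : Type} [Fintype α] [Fintype β] (e : α ≃ β) (p f : β → ℝ) :
    entFun (fun a => p (e a)) (fun a => f (e a)) = entFun p f := by
  unfold entFun
  rw [e.sum_comp fun b => p b * f b, e.sum_comp fun b => p b * negMulLog (f b)]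

section
variable {d n : ℕ} (lam : Set.Ioo (0 : ℝ) 1)

theorem boolClustering_prior_apply (θ : Cube d) :
    (boolClustering d lam).prior θ = ∏ _j : Fin d, (1 / 2 : ℝ) := by
  change 1 / (Fintype.card (Fin d → ℤˣ) : ℝ) = _
  simp

theorem boolClustering_law_apply (θ x : Cube d) :
    (boolClustering d lam).law θ x = ∏ j, flipDist (crossover lam) (θ j) (x j) := rfl

theorem boolClustering_law_comm (θ x : Cube d) :
    (boolClustering d lam).law θ x = (boolClustering d lam).law x θ := by
  simp only [boolClustering_law_apply, flipDist_comm lam (θ _)]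

theorem boolClustering_null_apply (x : Cube d) :
    (boolClustering d lam).null x = (boolClustering d lam).prior x := by
  change ∑ θ, (boolClustering d lam).prior θ * (boolClustering d lam).law θ x = _
  have h1 : ∑ θ, (boolClustering d lam).law x θ = 1 := ((boolClustering d lam).law x).2.2
  simp only [boolClustering_law_comm lam _ x, boolClustering_prior_apply, ← Finset.mul_sum, h1,
    mul_one]

/-- The coordinates of the data set are independent given `θ`, each consisting of `n` noisy copies
of the corresponding coordinate of `θ`. -/
theorem boolClustering_dataLaw_apply (θ : Cube d) (Y : Fin d → Fin n → ℤˣ) :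
    (boolClustering d lam).dataLaw n θ (fun i j => Y j i) = ∏ j, sampleLaw lam n (θ j) (Y j) := by
  change ∏ i, ∏ j, flipDist (crossover lam) (θ j) (Y j i) =
    ∏ j, ∏ i, flipDist (crossover lam) (θ j) (Y j i)
  exact Finset.prod_comm

theorem sum_dataLaw (θ : Cube d) (F : (Fin n → Cube d) → ℝ) :
    ∑ S, (boolClustering d lam).dataLaw n θ S * F S =
      ∑ Y : Fin d → Fin n → ℤˣ, (∏ j, sampleLaw lam n (θ j) (Y j)) * F (fun i j => Y j i) := by
  rw [← (Equiv.piComm fun (_ : Fin d) (_ : Fin n) => ℤˣ).sum_comp]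
  refine Finset.sum_congr rfl fun Y _ => ?_
  rw [← boolClustering_dataLaw_apply]
  rfl

variable {M : Type} [Fintype M] (A : Learner n (Cube d) M)

/-- The law of the learned model given `θ`. -/
noncomputable def modelLaw (θ : Cube d) : stdSimplex ℝ M :=
  mix ((boolClustering d lam).dataLaw n θ) A.run

/-- The law of the learned model given an independent test point `x` from the cluster of `θ`: by the
symmetry of the channel, `θ` given `x` is distributed like `x` given `θ`. -/
noncomputable def modelLawTest (x : Cube d) : stdSimplex ℝ M :=
  mix ((boolClustering d lam).law x) (modelLaw lam A)

/-- The information `I(A; θ)` that the model carries about the parameter. -/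
noncomputable def paramInfo : ℝ := mutualInfo (boolClustering d lam).prior (modelLaw lam A)

/-- The information `I(A; X)` that the model carries about a test point from the same cluster. -/
noncomputable def testInfo : ℝ := mutualInfo (boolClustering d lam).prior (modelLawTest lam A)

theorem mem_nonneg : 0 ≤ (boolClustering d lam).mem A :=
  Finset.sum_nonneg fun θ _ => mul_nonneg ((boolClustering d lam).prior.2.1 θ)
    (mutualInfo_nonneg _ _)

theorem paramInfo_nonneg : 0 ≤ paramInfo lam A := mutualInfo_nonneg _ _

/-- The model's information about `θ` is a small fraction of its information about the data, which
by the chain rule is the sum of the excess memorization and the information about `θ`. -/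
theorem paramInfo_le (hn1 : 1 ≤ n) (hn : n * (lam : ℝ) ^ 2 ≤ 1) (hl : (lam : ℝ) ≤ 1 / 2) :
    paramInfo lam A ≤ 16 * lam ^ 2 * n * ((boolClustering d lam).mem A + paramInfo lam A) := by
  have h0 := lam.2.1
  set P := boolClustering d lam
  have hmem : P.mem A + paramInfo lam A =
      ∑ m, entFun (fun S => ∑ θ, P.prior θ * P.dataLaw n θ S) (fun S => A.run S m) := by
    simp only [entFun_mixture, Finset.sum_add_distrib]
    rw [Finset.sum_comm]
    congr 1
    · simp only [LearningProblem.mem, mutualInfo_eq_sum_entFun, Finset.mul_sum]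
    · rw [paramInfo, mutualInfo_eq_sum_entFun]
      rfl
  rw [hmem, Finset.mul_sum, paramInfo, mutualInfo_eq_sum_entFun]
  refine Finset.sum_le_sum fun m _ => ?_
  have h1 := entFun_pi_le (q := fun _ => (1 / 2 : ℝ)) (k := fun x y => sampleLaw lam n x y)
    (μ := sampleMarginal lam n) (η := 16 * lam ^ 2 * n) (fun _ => by norm_num)
    (fun x y => (sampleLaw lam n x).2.1 y) (fun y => rfl) (by positivity)
    (entFun_sampleLaw_le lam hn1 hn hl) d (fun Y => A.run (fun i j => Y j i) m)
    (fun Y => (A.run _).2.1 m)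
  refine le_trans (le_of_eq ?_) (h1.trans (le_of_eq ?_))
  · congr 1
    · funext θ; exact boolClustering_prior_apply lam θ
    · funext θ; exact sum_dataLaw lam θ fun S => A.run S m
  · congr 1
    rw [← entFun_comp_equiv (Equiv.piComm fun (_ : Fin d) (_ : Fin n) => ℤˣ)]
    congr 1
    funext Y
    simp only [sampleMarginal]
    rw [Fintype.prod_sum fun (j : Fin d) x => 1 / 2 * sampleLaw lam n x (Y j)]
    refine Finset.sum_congr rfl fun θ _ => ?_
    rw [Finset.prod_mul_distrib, ← boolClustering_prior_apply lam θ, ← boolClustering_dataLaw_apply]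
    rfl

/-- A test point retains at most a `2 lam²` fraction of the model's information about `θ`. -/
theorem testInfo_le : testInfo lam A ≤ 2 * lam ^ 2 * paramInfo lam A := by
  have h0 := lam.2.1
  rw [testInfo, paramInfo, mutualInfo_eq_sum_entFun, mutualInfo_eq_sum_entFun, Finset.mul_sum]
  refine Finset.sum_le_sum fun m _ => ?_
  have h1 := entFun_pi_le (q := fun _ => (1 / 2 : ℝ))
    (k := fun x y => flipDist (crossover lam) x y)
    (μ := fun _ => 1 / 2) (η := 2 * lam ^ 2) (fun _ => by norm_num)
    (fun x y => (flipDist _ x).2.1 y) (fun y => ?_) (by positivity)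
    (entFun_flipDist_le lam) d (fun θ => modelLaw lam A θ m) (fun θ => (modelLaw lam A θ).2.1 m)
  · have e : (fun θ => (boolClustering d lam).prior θ) =
        fun _ : Cube d => ∏ _j : Fin d, (1 / 2 : ℝ) :=
      funext (boolClustering_prior_apply lam)
    rw [e]
    exact h1
  · rw [sum_units_int, flipDist_crossover, flipDist_crossover]
    push_cast
    ring

theorem testInfo_le_log_card [Nonempty M] : testInfo lam A ≤ log (Fintype.card M) :=
  mutualInfo_le_log_card _ _

theorem paramInfo_le_dim : paramInfo lam A ≤ d := by
  refine (mutualInfo_uniform_le_log_card (modelLaw lam A)).trans ?_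
  have h : (Fintype.card (Cube d) : ℝ) = 2 ^ d := by simp
  rw [h, log_pow]
  have := log_two_lt_d9
  exact mul_le_of_le_one_right d.cast_nonneg (by linarith)

/-- The variational bound on the information that an accurate model carries about a test point,
with the test function `t * 1[the model accepts x]`. Here `a` and `b` are the probabilities that the
model accepts a test point from the cluster and from the null distribution, and `z` is a free
parameter of the tangent-line bound `log u ≤ u / z - 1 + log z`. -/
theorem exists_accept_probabilities : ∃ a b : ℝ, a ≤ 1 ∧ 0 ≤ b ∧
    (boolClustering d lam).err A = (1 - a) / 2 + b / 2 ∧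
    ∀ t z : ℝ, 0 < z → t * a ≤ testInfo lam A + (1 + b * (exp t - 1)) / z - 1 + log z := by
  set P := boolClustering d lam with hP
  let acc : M → Cube d → ℝ := fun m x => if A.predict m x = true then 1 else 0
  have hacc0 : ∀ m x, 0 ≤ acc m x := fun m x => by simp only [acc]; split_ifs <;> norm_num
  have hacc1 : ∀ m x, acc m x ≤ 1 := fun m x => by simp only [acc]; split_ifs <;> norm_num
  have hprior : ∑ x, P.prior x = 1 := P.prior.2.2
  let Q : M → ℝ := fun m => ∑ θ, P.prior θ * modelLaw lam A θ m
  have hQ0 : ∀ m, 0 ≤ Q m := fun m => Finset.sum_nonneg fun θ _ =>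
    mul_nonneg (P.prior.2.1 θ) ((modelLaw lam A θ).2.1 m)
  have hQ1 : ∑ m, Q m = 1 := (mix P.prior (modelLaw lam A)).2.2
  have hQx : ∀ m, ∑ x, P.prior x * modelLawTest lam A x m = Q m := fun m => by
    change ∑ x, P.prior x * ∑ θ, P.law x θ * modelLaw lam A θ m = _
    simp only [Finset.mul_sum]
    rw [Finset.sum_comm]
    refine Finset.sum_congr rfl fun θ _ => ?_
    have : ∑ x, P.prior x * P.law x θ = P.prior θ := boolClustering_null_apply lam θ
    simp only [← mul_assoc]
    rw [← Finset.sum_mul, this]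
  let b : M → ℝ := fun m => ∑ x, P.prior x * acc m x
  have hb0 : ∀ m, 0 ≤ b m := fun m => Finset.sum_nonneg fun x _ =>
    mul_nonneg (P.prior.2.1 x) (hacc0 m x)
  let a : M → ℝ := fun m => ∑ x, P.prior x * modelLawTest lam A x m * acc m x
  have ha : ∀ m, a m = ∑ θ, P.prior θ * modelLaw lam A θ m * ∑ x, P.law θ x * acc m x := by
    intro m
    change ∑ x, P.prior x * (∑ θ, P.law x θ * modelLaw lam A θ m) * acc m x = _
    simp only [Finset.mul_sum, Finset.sum_mul]
    rw [Finset.sum_comm]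
    refine Finset.sum_congr rfl fun θ _ => Finset.sum_congr rfl fun x _ => ?_
    rw [hP, boolClustering_law_comm lam θ x]
    simp only [boolClustering_prior_apply]
    ring
  refine ⟨∑ m, a m, ∑ m, Q m * b m, ?_, ?_, ?_, ?_⟩
  · rw [← hQ1]
    refine Finset.sum_le_sum fun m _ => ?_
    rw [← hQx]
    exact Finset.sum_le_sum fun x _ => mul_le_of_le_one_right
      (mul_nonneg (P.prior.2.1 x) ((modelLawTest lam A x).2.1 m)) (hacc1 m x)
  · exact Finset.sum_nonneg fun m _ => mul_nonneg (hQ0 m) (hb0 m)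
  · have hcls : ∀ θ m, P.clsErr θ (A.predict m) =
        (1 / 2) * (1 - ∑ x, P.law θ x * acc m x) + (1 / 2) * b m := fun θ m => by
      have h1 : ∑ x, P.law θ x = 1 := (P.law θ).2.2
      rw [LearningProblem.clsErr]
      congr 2
      · rw [← h1, ← Finset.sum_sub_distrib]
        refine Finset.sum_congr rfl fun x _ => ?_
        by_cases h : A.predict m x = true <;> simp [acc, h]
      · refine Finset.sum_congr rfl fun x _ => ?_
        rw [hP, boolClustering_null_apply]
        by_cases h : A.predict m x = true <;> simp [acc, h]
    have herr : P.err A = ∑ m, ∑ θ, P.prior θ * modelLaw lam A θ m * P.clsErr θ (A.predict m) := by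
      rw [LearningProblem.err, Finset.sum_comm]
      refine Finset.sum_congr rfl fun θ _ => ?_
      simp only [Finset.mul_sum]
      rw [Finset.sum_comm]
      refine Finset.sum_congr rfl fun m _ => ?_
      change _ = P.prior θ * (∑ S, P.dataLaw n θ S * A.run S m) * _
      rw [Finset.mul_sum, Finset.sum_mul]
      exact Finset.sum_congr rfl fun S _ => by ring
    rw [herr]
    have hm : ∀ m, ∑ θ, P.prior θ * modelLaw lam A θ m * P.clsErr θ (A.predict m) =
        (Q m - a m) / 2 + Q m * b m / 2 := fun m => by
      rw [ha]
      simp only [hcls, Q, Finset.sum_mul, ← Finset.sum_sub_distrib, Finset.sum_div,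
        ← Finset.sum_add_distrib]
      exact Finset.sum_congr rfl fun θ _ => by ring
    simp only [hm, Finset.sum_add_distrib, ← Finset.sum_div, Finset.sum_sub_distrib, hQ1]
  · intro t z hz
    have hDV : ∀ m, t * a m ≤ entFun (fun x => P.prior x) (fun x => modelLawTest lam A x m) +
        Q m * ((1 + b m * (exp t - 1)) / z - 1 + log z) := fun m => by
      have h := sum_mul_le_entFun_add P.prior.2.1 (fun x => (modelLawTest lam A x).2.1 m)
        (fun x => t * acc m x)
      have e1 : ∑ x, P.prior x * modelLawTest lam A x m * (t * acc m x) = t * a m := by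
        simp only [a, Finset.mul_sum]
        exact Finset.sum_congr rfl fun x _ => by ring
      have e2 : ∑ x, P.prior x * exp (t * acc m x) = 1 + b m * (exp t - 1) := by
        rw [← hprior]
        simp only [b, Finset.sum_mul, ← Finset.sum_add_distrib]
        refine Finset.sum_congr rfl fun x _ => ?_
        by_cases h : A.predict m x = true
        · simp [acc, h]
          ring
        · simp [acc, h]
      have hpos : 0 < ∑ x, P.prior x * exp (t * acc m x) := by
        refine Finset.sum_pos (fun x _ => mul_pos ?_ (exp_pos _)) Finset.univ_nonempty
        rw [boolClustering_prior_apply]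
        positivity
      refine h.trans' (le_of_eq e1.symm) |>.trans ?_
      change entFun _ _ + (∑ x, P.prior x * modelLawTest lam A x m) * _ ≤ _
      rw [hQx]
      refine add_le_add le_rfl (mul_le_mul_of_nonneg_left ?_ (hQ0 m))
      have hl := log_le_sub_one_of_pos (div_pos hpos hz)
      rw [log_div hpos.ne' hz.ne', e2] at hl
      change log (∑ x, P.prior x * exp (t * acc m x)) ≤ _
      rw [e2]
      linarith
    have hs := Finset.sum_le_sum fun m (_ : m ∈ Finset.univ) => hDV m
    rw [← Finset.mul_sum, Finset.sum_add_distrib, ← mutualInfo_eq_sum_entFun] at hs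
    refine hs.trans (le_of_eq ?_)
    have e : ∀ m, Q m * ((1 + b m * (exp t - 1)) / z - 1 + log z) =
        Q m * (1 / z - 1 + log z) + Q m * b m * ((exp t - 1) / z) := fun m => by ring
    simp only [e, Finset.sum_add_distrib, ← Finset.sum_mul, hQ1, testInfo]
    ring

theorem cAlpha_pos {α : ℝ} (h0 : 0 < α) (h1 : α < 1 / 2) : 0 < cAlpha α := by
  refine mul_pos (by linarith) (log_pos ?_)
  rw [lt_div_iff₀ h0]
  linarith

/-- An accurate model carries information of order `C_α` about a test point. -/
theorem cAlpha_le_testInfo {α : ℝ} (h0 : 0 < α) (h1 : α < 1 / 2)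
    (herr : (boolClustering d lam).err A ≤ α) : cAlpha α ≤ 64 * testInfo lam A := by
  obtain ⟨a, b, ha, hb, he, hI⟩ := exists_accept_probabilities lam A
  rw [he] at herr
  set I := testInfo lam A
  rcases le_or_gt α (1 / 16) with hα | hα
  · -- a strong test: `exp t = 1 / (2 α)`
    set X := log (1 / α) with hX
    have hX4 : 4 * log 2 ≤ X := by
      have : log ((2 : ℝ) ^ 4) ≤ X := log_le_log (by norm_num) (by
        rw [le_div_iff₀ h0]; linarith)
      rwa [log_pow] at this
    have hl2 := log_two_gt_d9
    have h := hI (X - log 2) 2 (by norm_num)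
    have e1 : exp (X - log 2) = 1 / (2 * α) := by
      rw [exp_sub, hX, exp_log (by positivity), exp_log (by norm_num)]
      field_simp
    have hbt : b * (exp (X - log 2) - 1) ≤ 1 := by
      have : b * (1 / (2 * α)) ≤ 1 := by
        rw [mul_one_div, div_le_one (by linarith)]; linarith
      rw [e1]; linarith
    have hC : cAlpha α ≤ (1 - 2 * α) * X := by
      refine mul_le_mul_of_nonneg_left (log_le_log (div_pos (by linarith) h0) ?_) (by linarith)
      gcongr
      linarith
    have ht : (X - log 2) * (1 - 2 * α) ≤ (X - log 2) * a :=
      mul_le_mul_of_nonneg_left (by linarith) (by linarith)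
    nlinarith
  · -- a weak test: `t` is half the advantage of the model
    have hg : 1 - 2 * α ≤ a - b := by linarith
    set t := (1 - 2 * α) / 2 with ht
    have htpos : 0 < t := by rw [ht]; linarith
    have ht1 : t ≤ 1 := by rw [ht]; linarith
    have h := hI t 1 one_pos
    have hexp : exp t - 1 ≤ t + t ^ 2 := by
      have := abs_exp_sub_one_sub_id_le (x := t) (by rw [abs_of_pos htpos]; exact ht1)
      have := (abs_le.1 this).2
      linarith
    have hb1 : b ≤ 1 := by linarith
    have hbt : b * (exp t - 1) ≤ b * t + t ^ 2 := by
      have h2 := mul_le_mul_of_nonneg_left hexp hb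
      have h3 := mul_le_of_le_one_left (sq_nonneg t) hb1
      linarith
    rw [log_one, div_one] at h
    have hC : cAlpha α ≤ (1 - 2 * α) * (16 * (1 - 2 * α)) := by
      refine mul_le_mul_of_nonneg_left ?_ (by linarith)
      have h2 := log_le_sub_one_of_pos (x := (1 - α) / α) (div_pos (by linarith) h0)
      have h3 : (1 - α) / α - 1 = (1 - 2 * α) / α := by field_simp; ring
      have h4 : (1 - 2 * α) / α ≤ 16 * (1 - 2 * α) := by
        rw [div_le_iff₀ h0]; nlinarith
      linarith
    nlinarith

/-- The memorization lower bound with an arbitrary `B ≥ 2` in the place of the logarithm. Its left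
side is at most `0` unless `8 lam² n B < 1`, which provides the smallness of `lam` and `lam² n` needed for
the contraction `paramInfo_le` with factor `16 lam² n ≤ 8 lam² n B`. -/
theorem mem_lower_bound {α B : ℝ} (h0 : 0 < α) (h1 : α < 1 / 2) (hn1 : 1 ≤ n)
    (herr : (boolClustering d lam).err A ≤ α) (hB : 2 ≤ B) :
    1 / 2048 * ((1 - 8 * (lam : ℝ) ^ 2 * n * B) / ((lam : ℝ) ^ 4 * n * B) * cAlpha α) ≤
      (boolClustering d lam).mem A := by
  have hlam := lam.2.1
  have hn0 : (1 : ℝ) ≤ n := by exact_mod_cast hn1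
  have hC := cAlpha_pos h0 h1
  have hmem := mem_nonneg lam A
  have hlam2 : 0 < (lam : ℝ) ^ 2 := by positivity
  rcases le_or_gt (1 - 8 * (lam : ℝ) ^ 2 * n * B) 0 with hneg | hpos
  · refine le_trans ?_ hmem
    exact mul_nonpos_of_nonneg_of_nonpos (by norm_num)
      (mul_nonpos_of_nonpos_of_nonneg (div_nonpos_of_nonpos_of_nonneg hneg (by positivity)) hC.le)
  · have hln : 0 < (lam : ℝ) ^ 2 * n := by positivity
    have h16 : 16 * ((lam : ℝ) ^ 2 * n) ≤ 8 * (lam : ℝ) ^ 2 * n * B := by nlinarith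
    have hl2 : (lam : ℝ) ^ 2 ≤ (lam : ℝ) ^ 2 * n := le_mul_of_one_le_right hlam2.le hn0
    have hJ := paramInfo_le lam A hn1 (by linarith) (by nlinarith)
    have hT := testInfo_le lam A
    have hE := cAlpha_le_testInfo lam A h0 h1 herr
    set J := paramInfo lam A
    set m := (boolClustering d lam).mem A
    rw [← mul_assoc, mul_div_assoc', div_mul_eq_mul_div, div_le_iff₀ (by positivity)]
    have hJC : cAlpha α ≤ 128 * lam ^ 2 * J := by linarith
    have hJ0 : 0 ≤ J := paramInfo_nonneg lam A
    calc 1 / 2048 * (1 - 8 * (lam : ℝ) ^ 2 * n * B) * cAlpha α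
        ≤ 1 / 2048 * (1 - 16 * ((lam : ℝ) ^ 2 * n)) * (128 * lam ^ 2 * J) := by
          gcongr
          linarith
      _ = lam ^ 2 / 16 * ((1 - 16 * ((lam : ℝ) ^ 2 * n)) * J) := by ring
      _ ≤ lam ^ 2 / 16 * (16 * lam ^ 2 * n * m) := by
          exact mul_le_mul_of_nonneg_left (by linarith) (by positivity)
      _ = m * (lam ^ 4 * n * 1) := by ring
      _ ≤ m * (lam ^ 4 * n * B) := by
          gcongr
          linarith

end

/-! ### The correlation of a majority vote -/

/-- The majority vote of `n` signs, with ties broken towards `1`. -/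
def signVote {n : ℕ} (y : Fin n → ℤˣ) : ℤˣ := if 0 ≤ ∑ i, (y i : ℤ) then 1 else -1

theorem signVote_spec {n : ℕ} (y : Fin n → ℤˣ) :
    (0 ≤ signSum y ∧ signVote y = 1) ∨ (signSum y < 0 ∧ signVote y = -1) := by
  have hc : signSum y = ((∑ i, (y i : ℤ) : ℤ) : ℝ) := by simp [signSum]
  rw [hc]
  by_cases h : 0 ≤ ∑ i, (y i : ℤ)
  · exact Or.inl ⟨by exact_mod_cast h, if_pos h⟩
  · exact Or.inr ⟨by exact_mod_cast not_le.1 h, if_neg h⟩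

/-- The powers of `1 + i x` stay close to the line `1 + i k x` as long as `k x ≤ 1`. -/
theorem one_add_mul_I_pow_bounds {x : ℝ} (hx : 0 ≤ x) (k : ℕ) (hk : k * x ≤ 1) :
    1 - (k * x) ^ 2 / 2 ≤ ((1 + x * Complex.I) ^ k).re ∧ ((1 + x * Complex.I) ^ k).re ≤ 1 ∧
      k * x / 2 ≤ ((1 + x * Complex.I) ^ k).im ∧ ((1 + x * Complex.I) ^ k).im ≤ k * x := by
  induction k with
  | zero => simp
  | succ k ih =>
    push_cast at hk ⊢
    have hk0 : 0 ≤ k * x := by positivity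
    obtain ⟨h1, h2, h3, h4⟩ := ih (by linarith)
    have hre : ((1 + x * Complex.I) ^ (k + 1)).re =
        ((1 + x * Complex.I) ^ k).re - x * ((1 + x * Complex.I) ^ k).im := by
      rw [pow_succ]; simp; ring
    have him : ((1 + x * Complex.I) ^ (k + 1)).im =
        ((1 + x * Complex.I) ^ k).im + x * ((1 + x * Complex.I) ^ k).re := by
      rw [pow_succ]; simp; ring
    rw [hre, him]
    set a := ((1 + x * Complex.I) ^ k).re
    set b := ((1 + x * Complex.I) ^ k).im
    refine ⟨?_, ?_, ?_, ?_⟩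
    · have := mul_le_mul_of_nonneg_left h4 hx
      nlinarith [sq_nonneg x]
    · have := mul_nonneg hx (by linarith : 0 ≤ b)
      linarith
    · have h5 : 1 / 2 ≤ a := by nlinarith
      have := mul_le_mul_of_nonneg_left h5 hx
      linarith
    · have := mul_le_mul_of_nonneg_left h2 hx
      linarith

section
variable (lam : Set.Ioo (0 : ℝ) 1)

/-- The correlation of the majority vote of `n` noisy copies with a uniform sign. -/
noncomputable def voteCorr (n : ℕ) : ℝ :=
  ∑ y : Fin n → ℤˣ, (sampleLaw lam n 1 y - sampleLaw lam n (-1) y) / 2 * ((signVote y : ℤ) : ℝ)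

/-- Among the functions of the data that are bounded by `1`, the majority vote has the largest
correlation with the sign; `sin` is a competitor whose expectation is explicit. -/
theorem sum_sampleLaw_mul_sin_le (n : ℕ) (s : ℝ) :
    ∑ y, sampleLaw lam n 1 y * sin (s * signSum y) ≤ voteCorr lam n := by
  have hsym : ∑ y, sampleLaw lam n (-1) y * sin (s * signSum y) =
      -∑ y, sampleLaw lam n 1 y * sin (s * signSum y) := by
    rw [← Equiv.sum_comp (Equiv.neg (Fin n → ℤˣ)), ← Finset.sum_neg_distrib]
    refine Finset.sum_congr rfl fun y _ => ?_
    simp only [Equiv.neg_apply, sampleLaw_neg, neg_neg, signSum_neg, mul_neg, sin_neg]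
  have e : ∑ y, sampleLaw lam n 1 y * sin (s * signSum y) =
      ∑ y, (sampleLaw lam n 1 y - sampleLaw lam n (-1) y) / 2 * sin (s * signSum y) := by
    have : ∀ y : Fin n → ℤˣ, (sampleLaw lam n 1 y - sampleLaw lam n (-1) y) / 2 *
        sin (s * signSum y) = (sampleLaw lam n 1 y * sin (s * signSum y)
          - sampleLaw lam n (-1) y * sin (s * signSum y)) / 2 := fun y => by ring
    simp only [this, ← Finset.sum_div, Finset.sum_sub_distrib, hsym]
    ring
  rw [e]
  refine Finset.sum_le_sum fun y _ => ?_
  have ha := (artanh_pos lam.2).le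
  have hK : 0 ≤ (1 / 2) ^ n * exp (n * ((log (1 + (lam : ℝ)) + log (1 - lam)) / 2)) := by positivity
  rcases signVote_spec y with ⟨h, hv⟩ | ⟨h, hv⟩
  · have : sampleLaw lam n (-1) y ≤ sampleLaw lam n 1 y := by
      rw [sampleLaw_eq_exp, sampleLaw_eq_exp]
      refine mul_le_mul_of_nonneg_left (exp_le_exp.2 ?_) hK
      have := mul_nonneg ha h
      push_cast
      linarith
    refine mul_le_mul_of_nonneg_left ?_ (by linarith)
    rw [hv]
    simpa using sin_le_one _
  · have : sampleLaw lam n 1 y ≤ sampleLaw lam n (-1) y := by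
      rw [sampleLaw_eq_exp, sampleLaw_eq_exp]
      refine mul_le_mul_of_nonneg_left (exp_le_exp.2 ?_) hK
      have := mul_nonpos_of_nonneg_of_nonpos ha h.le
      push_cast
      linarith
    refine mul_le_mul_of_nonpos_left ?_ (by linarith)
    rw [hv]
    simpa using neg_one_le_sin _

theorem sum_sampleLaw_mul_sin_eq (n : ℕ) (s : ℝ) :
    ∑ y, sampleLaw lam n 1 y * sin (s * signSum y) =
      ((cos s + lam * sin s * Complex.I : ℂ) ^ n).im := by
  have e : ∀ y : Fin n → ℤˣ, ((sampleLaw lam n 1 y : ℝ) : ℂ) *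
      Complex.exp ((s * signSum y : ℝ) * Complex.I) =
      ∏ i, ((flipDist (crossover lam) 1 (y i) : ℝ) : ℂ) *
        Complex.exp ((s * ((y i : ℤ) : ℝ) : ℝ) * Complex.I) := fun y => by
    rw [Finset.prod_mul_distrib, ← Complex.exp_sum, ← Finset.sum_mul, ← Complex.ofReal_sum,
      ← Complex.ofReal_prod, ← Finset.mul_sum]
    rfl
  have h1 : ∑ y : Fin n → ℤˣ, ((sampleLaw lam n 1 y : ℝ) : ℂ) *
      Complex.exp ((s * signSum y : ℝ) * Complex.I) =
      (cos s + lam * sin s * Complex.I : ℂ) ^ n := by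
    simp only [e]
    rw [← Fintype.prod_sum fun (_ : Fin n) z => ((flipDist (crossover lam) 1 z : ℝ) : ℂ) *
        Complex.exp ((s * ((z : ℤ) : ℝ) : ℝ) * Complex.I)]
    rw [Finset.prod_const, Finset.card_univ, Fintype.card_fin,
      show (Finset.univ : Finset ℤˣ) = {1, -1} from rfl, Finset.sum_pair (by decide),
      flipDist_crossover, flipDist_crossover, Complex.exp_mul_I, Complex.exp_mul_I]
    congr 1
    push_cast
    simp only [mul_one, mul_neg, Complex.cos_neg, Complex.sin_neg]
    ring
  rw [← h1, Complex.im_sum]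
  refine Finset.sum_congr rfl fun y _ => ?_
  rw [Complex.im_ofReal_mul, Complex.exp_ofReal_mul_I_im]

/-- The correlation of the majority vote is at least of order `min 1 (lam √n)`. -/
theorem le_voteCorr {n : ℕ} (hn : 1 ≤ n) {m : ℝ} (hm0 : 0 ≤ m) (hm1 : m ≤ 1)
    (hm : m ^ 2 ≤ lam ^ 2 * n) : m / 8 ≤ voteCorr lam n := by
  have h0 := lam.2.1
  have hn0 : (1 : ℝ) ≤ n := by exact_mod_cast hn
  -- `s = min (1 / √n) (1 / (lam n)) / 2`, up to the slack in `m`: then `cos s ^ n` is bounded below,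
  -- and `n * lam * tan s` is of order `m` but at most `1`
  set s := m / (2 * lam * n) with hs
  have hs0 : 0 ≤ s := by positivity
  have hlns : (lam : ℝ) * n * s = m / 2 := by rw [hs]; field_simp
  have hns : n * s ^ 2 ≤ 1 / 4 := by
    have : n * s ^ 2 = m ^ 2 / (lam ^ 2 * n) / 4 := by rw [hs]; field_simp; ring
    rw [this]
    have := (div_le_one (by positivity)).2 hm
    linarith
  have hs2 : s ^ 2 ≤ 1 / 4 := le_trans (le_mul_of_one_le_left (sq_nonneg s) hn0) hns
  have hs1 : s ≤ 1 / 2 := by nlinarith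
  have hcos : 1 - s ^ 2 / 2 ≤ cos s := one_sub_sq_div_two_le_cos
  have hcos0 : 0 < cos s := by linarith
  set x := lam * tan s with hx
  have htan1 : s ≤ tan s := le_tan hs0 (by have := pi_gt_three; linarith)
  have htan2 : tan s ≤ 2 * s := by
    rw [tan_eq_sin_div_cos, div_le_iff₀ hcos0]
    have := sin_le hs0
    nlinarith
  have hx0 : 0 ≤ x := mul_nonneg h0.le (hs0.trans htan1)
  have hnx1 : m / 2 ≤ n * x := by
    rw [← hlns, hx]
    have := mul_le_mul_of_nonneg_left htan1 (by positivity : 0 ≤ lam * (n : ℝ))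
    linarith
  have hnx2 : n * x ≤ 1 := by
    have := mul_le_mul_of_nonneg_left htan2 (by positivity : 0 ≤ lam * (n : ℝ))
    rw [hx]
    linarith
  have him := (one_add_mul_I_pow_bounds hx0 n hnx2).2.2.1
  have hz : (cos s + lam * sin s * Complex.I : ℂ) = ((cos s : ℝ) : ℂ) * (1 + x * Complex.I) := by
    have : ((cos s : ℝ) : ℂ) * ((x : ℝ) : ℂ) = lam * sin s := by
      rw [← Complex.ofReal_mul, ← Complex.ofReal_mul, hx, tan_eq_sin_div_cos]
      congr 1
      field_simp
    rw [mul_add, mul_one, ← mul_assoc, this]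
  have hpow : 7 / 8 ≤ cos s ^ n := by
    have h1 := one_add_mul_le_pow (a := -(s ^ 2 / 2)) (by linarith) n
    have h2 := pow_le_pow_left₀ (by linarith : 0 ≤ 1 + -(s ^ 2 / 2)) (by linarith) n (b := cos s)
    linarith
  refine le_trans ?_ (sum_sampleLaw_mul_sin_le lam n s)
  rw [sum_sampleLaw_mul_sin_eq, hz, mul_pow, ← Complex.ofReal_pow, Complex.im_ofReal_mul]
  nlinarith

theorem voteCorr_le_one (n : ℕ) : voteCorr lam n ≤ 1 := by
  have h1 : ∑ y, sampleLaw lam n 1 y = 1 := (sampleLaw lam n 1).2.2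
  have h2 : ∑ y, sampleLaw lam n (-1) y = 1 := (sampleLaw lam n (-1)).2.2
  have h3 : (1 : ℝ) = ∑ y, (sampleLaw lam n 1 y + sampleLaw lam n (-1) y) / 2 := by
    rw [← Finset.sum_div, Finset.sum_add_distrib, h1, h2]; norm_num
  rw [h3]
  refine Finset.sum_le_sum fun y _ => ?_
  have p1 : 0 ≤ sampleLaw lam n 1 y := (sampleLaw lam n 1).2.1 y
  have p2 : 0 ≤ sampleLaw lam n (-1) y := (sampleLaw lam n (-1)).2.1 y
  rcases signVote_spec y with ⟨_, h⟩ | ⟨_, h⟩ <;> rw [h] <;> push_cast <;> linarith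

/-- The probability that the majority vote is wrong decays exponentially in `lam² n`. -/
theorem sum_sampleLaw_vote_ne_le (n : ℕ) (x : ℤˣ) :
    ∑ y : Fin n → ℤˣ, (if signVote y = x then 0 else sampleLaw lam n x y) ≤
      exp (-(n * lam ^ 2 / 2)) := by
  have h0 := lam.2.1
  have h1 := lam.2.2
  have ha := (artanh_pos lam.2).le
  have hb : log (1 + (lam : ℝ)) + log (1 - lam) ≤ -lam ^ 2 := by
    rw [← log_mul (by linarith) (by linarith)]
    have := log_le_sub_one_of_pos (x := (1 + (lam : ℝ)) * (1 - lam))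
      (mul_pos (by linarith) (by linarith))
    linarith
  set K := exp (n * ((log (1 + (lam : ℝ)) + log (1 - lam)) / 2)) with hK
  have hle : ∀ y : Fin n → ℤˣ, (if signVote y = x then 0 else sampleLaw lam n x y) ≤
      (1 / 2) ^ n * K := fun y => by
    split_ifs with h
    · positivity
    · rw [sampleLaw_eq_exp]
      refine mul_le_of_le_one_right (by positivity) (exp_le_one_iff.2 ?_)
      rcases signVote_spec y with ⟨hT, hv⟩ | ⟨hT, hv⟩
      · have hx : x = -1 := (Int.units_eq_one_or x).resolve_left fun h2 => h (hv.trans h2.symm)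
        have := mul_nonneg ha hT
        rw [hx]; push_cast; linarith
      · have hx : x = 1 := (Int.units_eq_one_or x).resolve_right fun h2 => h (hv.trans h2.symm)
        have := mul_nonpos_of_nonneg_of_nonpos ha hT.le
        rw [hx]; push_cast; linarith
  refine (Finset.sum_le_sum fun y _ => hle y).trans ?_
  rw [Finset.sum_const, Finset.card_univ, Fintype.card_fun, Fintype.card_fin, nsmul_eq_mul]
  have : ((Fintype.card ℤˣ ^ n : ℕ) : ℝ) * ((1 / 2) ^ n * K) = K := by
    rw [show Fintype.card ℤˣ = 2 from rfl, ← mul_assoc, Nat.cast_pow, ← mul_pow]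
    norm_num
  rw [this, hK, exp_le_exp]
  have := mul_le_mul_of_nonneg_left hb (n.cast_nonneg (α := ℝ))
  linarith

end

/-! ### Error and memorization of the majority learner -/

section
variable {n d : ℕ} (lam : Set.Ioo (0 : ℝ) 1)

theorem sum_majorityLearner_run (t : ℕ) (s : ℝ) (S : Fin n → Cube d) (F : (Cube d → Bool) → ℝ) :
    ∑ h, (majorityLearner n d t s).run S h * F h = F (linearClassifier t s (majorityVote S)) := by
  change ∑ h, (Pi.single (linearClassifier t s (majorityVote S)) 1 : (Cube d → Bool) → ℝ) h * F h
    = _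
  rw [Finset.sum_eq_single (linearClassifier t s (majorityVote S))]
  · simp
  · intro h _ hne
    simp [Pi.single_eq_of_ne hne]
  · simp

/-- The inner product of `u` and `x` on the first `t` coordinates. -/
noncomputable def innerFirst (t : ℕ) (u x : Cube d) : ℝ :=
  ∑ j : Fin d, if (j : ℕ) < t then (((u j : ℤ) * (x j : ℤ) : ℤ) : ℝ) else 0

theorem linearClassifier_eq_true_iff (t : ℕ) (s : ℝ) (u x : Cube d) :
    linearClassifier t s u x = true ↔ s ≤ innerFirst t u x := by
  simp [linearClassifier, innerFirst]

theorem prod_ite_lt {t : ℕ} (ht : t ≤ d) (c : ℝ) :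
    ∏ j : Fin d, (if (j : ℕ) < t then c else 1) = c ^ t := by
  rw [Fin.prod_univ_eq_prod_range (fun j => if j < t then c else 1) d, ← Finset.prod_filter,
    Finset.prod_const]
  congr 1
  have : Finset.filter (fun j => j < t) (Finset.range d) = Finset.range t := by
    ext j; simp; omega
  rw [this, Finset.card_range]

theorem exp_mul_innerFirst (t : ℕ) (v : ℝ) (u x : Cube d) :
    exp (v * innerFirst t u x) =
      ∏ j : Fin d, if (j : ℕ) < t then exp (v * (((u j : ℤ) : ℝ) * ((x j : ℤ) : ℝ))) else 1 := by
  rw [innerFirst, Finset.mul_sum, exp_sum]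
  refine Finset.prod_congr rfl fun j _ => ?_
  split_ifs <;> simp

theorem sum_flipDist_mul_exp (x u : ℤˣ) (v : ℝ) :
    ∑ z, flipDist (crossover lam) x z * exp (v * (((u : ℤ) : ℝ) * ((z : ℤ) : ℝ))) =
      cosh v + lam * ((x : ℤ) : ℝ) * ((u : ℤ) : ℝ) * sinh v := by
  rw [sum_units_int, flipDist_crossover, flipDist_crossover, cosh_eq, sinh_eq]
  rcases Int.units_eq_one_or u with rfl | rfl <;> push_cast <;> ring_nf

theorem sum_prior_mul_exp {t : ℕ} (ht : t ≤ d) (v : ℝ) (u : Cube d) :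
    ∑ x, (boolClustering d lam).prior x * exp (v * innerFirst t u x) = cosh v ^ t := by
  simp only [boolClustering_prior_apply, exp_mul_innerFirst, ← Finset.prod_mul_distrib]
  rw [← Fintype.prod_sum fun (j : Fin d) (z : ℤˣ) => (1 / 2 : ℝ) *
    (if (j : ℕ) < t then exp (v * (((u j : ℤ) : ℝ) * ((z : ℤ) : ℝ))) else 1), ← prod_ite_lt ht]
  refine Finset.prod_congr rfl fun j _ => ?_
  rw [sum_units_int]
  split_ifs
  · rw [cosh_eq]
    rcases Int.units_eq_one_or (u j) with h | h <;> rw [h] <;> push_cast <;> ring_nf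
  · norm_num

/-- The moment generating function of the inner product between the majority vote and a test point
from the cluster. Averaged over `θ`, its coordinates are independent signs with mean
`lam * voteCorr`. -/
theorem sum_prior_dataLaw_law_mul_exp {t : ℕ} (ht : t ≤ d) (v : ℝ) :
    ∑ θ, (boolClustering d lam).prior θ * ∑ S, (boolClustering d lam).dataLaw n θ S *
      ∑ x, (boolClustering d lam).law θ x * exp (v * innerFirst t (majorityVote S) x) =
      (cosh v + lam * voteCorr lam n * sinh v) ^ t := by
  let G : ℕ → ℤˣ → ℤˣ → ℝ := fun j u z =>
    if j < t then exp (v * (((u : ℤ) : ℝ) * ((z : ℤ) : ℝ))) else 1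
  have hG : ∀ j x u, ∑ z, flipDist (crossover lam) x z * G j u z =
      if j < t then cosh v + lam * ((x : ℤ) : ℝ) * ((u : ℤ) : ℝ) * sinh v else 1 := fun j x u => by
    by_cases h : j < t
    · simp only [G, h, if_true, sum_flipDist_mul_exp]
    · simp only [G, h, if_false, mul_one]
      exact (flipDist (crossover lam) x).2.2
  have hx : ∀ θ u : Cube d, ∑ x, (boolClustering d lam).law θ x * exp (v * innerFirst t u x) =
      ∏ j : Fin d, ∑ z, flipDist (crossover lam) (θ j) z * G j (u j) z := fun θ u => by
    rw [Fintype.prod_sum]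
    refine Finset.sum_congr rfl fun x _ => ?_
    rw [boolClustering_law_apply, exp_mul_innerFirst, Finset.prod_mul_distrib]
  have hS : ∀ θ : Cube d, ∑ S, (boolClustering d lam).dataLaw n θ S *
      ∑ x, (boolClustering d lam).law θ x * exp (v * innerFirst t (majorityVote S) x) =
      ∏ j : Fin d, ∑ y, sampleLaw lam n (θ j) y *
        ∑ z, flipDist (crossover lam) (θ j) z * G j (signVote y) z := fun θ => by
    rw [sum_dataLaw, Fintype.prod_sum]
    refine Finset.sum_congr rfl fun Y _ => ?_
    rw [hx, Finset.prod_mul_distrib]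
    rfl
  simp only [hS, boolClustering_prior_apply, ← Finset.prod_mul_distrib]
  rw [← Fintype.prod_sum fun (j : Fin d) x => (1 / 2 : ℝ) * ∑ y, sampleLaw lam n x y *
        ∑ z, flipDist (crossover lam) x z * G j (signVote y) z, ← prod_ite_lt ht]
  refine Finset.prod_congr rfl fun j _ => ?_
  simp only [hG]
  have h1 : ∑ y, sampleLaw lam n 1 y = 1 := (sampleLaw lam n 1).2.2
  have h2 : ∑ y, sampleLaw lam n (-1) y = 1 := (sampleLaw lam n (-1)).2.2
  rw [sum_units_int]
  split_ifs with h
  · have e : ∀ y : Fin n → ℤˣ, 1 / 2 * (sampleLaw lam n 1 y *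
        (cosh v + lam * (((1 : ℤˣ) : ℤ) : ℝ) * ((signVote y : ℤ) : ℝ) * sinh v)) +
        1 / 2 * (sampleLaw lam n (-1) y *
        (cosh v + lam * (((-1 : ℤˣ) : ℤ) : ℝ) * ((signVote y : ℤ) : ℝ) * sinh v)) =
        cosh v / 2 * sampleLaw lam n 1 y + cosh v / 2 * sampleLaw lam n (-1) y +
        lam * sinh v * ((sampleLaw lam n 1 y - sampleLaw lam n (-1) y) / 2 *
          ((signVote y : ℤ) : ℝ)) := fun y => by push_cast; ring
    rw [Finset.mul_sum, Finset.mul_sum, ← Finset.sum_add_distrib]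
    simp only [e, Finset.sum_add_distrib, ← Finset.mul_sum, h1, h2, voteCorr]
    ring
  · simp only [mul_one, h1, h2]
    norm_num

/-- The Chernoff bound for the error of the majority learner: the first term bounds the probability of
rejecting a point from the cluster, the second that of accepting a point from the null
distribution. -/
theorem err_majorityLearner_le_chernoff {t : ℕ} (ht : t ≤ d) (s : ℝ) {v : ℝ} (hv : 0 ≤ v) :
    (boolClustering d lam).err (majorityLearner n d t s) ≤
      (1 / 2) * (exp (v * s) * (cosh v - lam * voteCorr lam n * sinh v) ^ t) +
        (1 / 2) * (exp (-(v * s)) * cosh v ^ t) := by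
  set P := boolClustering d lam with hP
  have hcls : ∀ θ u : Cube d, P.clsErr θ (linearClassifier t s u) ≤
      (1 / 2) * (exp (v * s) * ∑ x, P.law θ x * exp (-v * innerFirst t u x)) +
        (1 / 2) * (exp (-(v * s)) * cosh v ^ t) := fun θ u => by
    rw [← sum_prior_mul_exp lam ht v u, LearningProblem.clsErr, Finset.mul_sum (a := exp (v * s)),
      Finset.mul_sum (a := exp (-(v * s)))]
    gcongr with x _ x _
    · have hp : 0 ≤ P.law θ x := (P.law θ).2.1 x
      rw [mul_left_comm, ← exp_add]
      split_ifs with h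
      · positivity
      · rw [linearClassifier_eq_true_iff, not_le] at h
        refine le_mul_of_one_le_right hp (one_le_exp ?_)
        have := mul_le_mul_of_nonneg_left h.le hv
        linarith
    · have hp : 0 ≤ P.prior x := P.prior.2.1 x
      rw [hP, boolClustering_null_apply, ← hP, mul_left_comm, ← exp_add]
      split_ifs with h
      · positivity
      · rw [Bool.not_eq_false, linearClassifier_eq_true_iff] at h
        refine le_mul_of_one_le_right hp (one_le_exp ?_)
        have := mul_le_mul_of_nonneg_left h hv
        linarith
  have hmgf := sum_prior_dataLaw_law_mul_exp (n := n) lam ht (-v)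
  rw [cosh_neg, sinh_neg, mul_neg, ← sub_eq_add_neg] at hmgf
  rw [← hmgf]
  have hprior : ∑ θ, P.prior θ = 1 := P.prior.2.2
  have hdata : ∀ θ, ∑ S, P.dataLaw n θ S = 1 := fun θ => (P.dataLaw n θ).2.2
  have e : (1 / 2) * (exp (v * s) * ∑ θ, P.prior θ * ∑ S, P.dataLaw n θ S *
      ∑ x, P.law θ x * exp (-v * innerFirst t (majorityVote S) x)) +
        (1 / 2) * (exp (-(v * s)) * cosh v ^ t) =
      ∑ θ, P.prior θ * ∑ S, P.dataLaw n θ S *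
        ((1 / 2) * (exp (v * s) * ∑ x, P.law θ x * exp (-v * innerFirst t (majorityVote S) x)) +
        (1 / 2) * (exp (-(v * s)) * cosh v ^ t)) := by
    simp only [mul_add, Finset.sum_add_distrib, ← Finset.sum_mul, hdata, hprior, one_mul]
    congr 1
    simp only [Finset.mul_sum]
    exact Finset.sum_congr rfl fun _ _ => Finset.sum_congr rfl fun _ _ =>
      Finset.sum_congr rfl fun _ _ => by ring
  rw [e, LearningProblem.err]
  refine Finset.sum_le_sum fun θ _ => mul_le_mul_of_nonneg_left ?_ (P.prior.2.1 θ)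
  refine Finset.sum_le_sum fun S _ => mul_le_mul_of_nonneg_left ?_ ((P.dataLaw n θ).2.1 S)
  exact (sum_majorityLearner_run t s S fun h => P.clsErr θ h).trans_le (hcls θ _)

/-- With the threshold half way between the two means, the error of the majority learner is
exponentially small in the squared signal-to-noise ratio. -/
theorem err_majorityLearner_le {t : ℕ} (ht : t ≤ d) (h0 : 0 ≤ voteCorr lam n) :
    (boolClustering d lam).err (majorityLearner n d t (t * (lam * voteCorr lam n) / 2)) ≤
      exp (-(t * (lam * voteCorr lam n) ^ 2 / 16)) := by
  have hl0 := lam.2.1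
  have hl1 := lam.2.2
  set c := lam * voteCorr lam n with hc
  have hc0 : 0 ≤ c := mul_nonneg hl0.le h0
  have hc1 : c ≤ 1 := mul_le_one₀ hl1.le h0 (voteCorr_le_one lam n)
  have ht0 : (0 : ℝ) ≤ t := t.cast_nonneg
  refine (err_majorityLearner_le_chernoff lam ht (t * c / 2) (v := c / 2) (by linarith)).trans ?_
  rw [← hc]
  have hv2 : cosh (c / 2) ≤ exp ((c / 2) ^ 2 / 2) := cosh_le_exp_half_sq _
  have hb1 : cosh (c / 2) - c * sinh (c / 2) ≤ exp (-(5 * c ^ 2 / 16)) := by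
    have h1 : c / 2 ≤ sinh (c / 2) := self_le_sinh_iff.2 (by linarith)
    have h2 : c ^ 2 / 2 ≤ c * sinh (c / 2) := by nlinarith
    have h3 : exp (-(c ^ 2 / 8)) * exp ((c / 2) ^ 2 / 2) = 1 := by
      rw [← exp_add, exp_eq_one_iff]; ring
    have h4 := add_one_le_exp (-(c ^ 2 / 8))
    have h5 := add_one_le_exp (-(7 * c ^ 2 / 16))
    have hE := exp_pos ((c / 2) ^ 2 / 2)
    calc cosh (c / 2) - c * sinh (c / 2) ≤ exp ((c / 2) ^ 2 / 2) - c ^ 2 / 2 * 1 := by linarith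
      _ = exp ((c / 2) ^ 2 / 2) * (1 - c ^ 2 / 2 * exp (-(c ^ 2 / 8))) := by
          linear_combination c ^ 2 / 2 * h3
      _ ≤ exp ((c / 2) ^ 2 / 2) * exp (-(7 * c ^ 2 / 16)) := by
          refine mul_le_mul_of_nonneg_left (le_trans ?_ h5) hE.le
          have h6 := mul_le_mul_of_nonneg_left h4 (sq_nonneg c)
          have h7 : c ^ 2 * c ^ 2 ≤ c ^ 2 * 1 :=
            mul_le_mul_of_nonneg_left (pow_le_one₀ hc0 hc1) (sq_nonneg c)
          linarith
      _ = _ := by rw [← exp_add]; ring_nf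
  have hb0 : 0 ≤ cosh (c / 2) - c * sinh (c / 2) := by
    have := (cosh_add_mul_sinh_le (c := -c) (s := c / 2) (abs_le.2 ⟨by linarith, by linarith⟩)).1
    linarith
  have p1 := pow_le_pow_left₀ hb0 hb1 t
  have p2 := pow_le_pow_left₀ (cosh_pos _).le hv2 t
  rw [← exp_nat_mul] at p1 p2
  have q1 : exp (c / 2 * (t * c / 2)) * (cosh (c / 2) - c * sinh (c / 2)) ^ t ≤
      exp (-(t * c ^ 2 / 16)) := by
    refine (mul_le_mul_of_nonneg_left p1 (exp_pos _).le).trans (le_of_eq ?_)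
    rw [← exp_add]; ring_nf
  have q2 : exp (-(c / 2 * (t * c / 2))) * cosh (c / 2) ^ t ≤ exp (-(t * c ^ 2 / 16)) := by
    refine (mul_le_mul_of_nonneg_left p2 (exp_pos _).le).trans ?_
    rw [← exp_add, exp_le_exp]
    have := mul_nonneg ht0 (sq_nonneg c)
    nlinarith
  linarith

/-- The majority learner is accurate once `t (lam * voteCorr)² ≥ 1600`. -/
theorem err_majorityLearner_le_of_le {t : ℕ} (ht : t ≤ d) {m : ℝ} (hn : 1 ≤ n) (hm0 : 0 ≤ m)
    (hm1 : m ≤ 1) (hm : m ^ 2 ≤ lam ^ 2 * n) (h : 1600 * 64 ≤ (t : ℝ) * ((lam : ℝ) ^ 2 * m ^ 2)) :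
    ∃ s, (boolClustering d lam).err (majorityLearner n d t s) ≤ 0.01 := by
  have hl0 := lam.2.1
  have hγ := le_voteCorr lam hn hm0 hm1 hm
  refine ⟨_, (err_majorityLearner_le lam ht (by linarith)).trans ?_⟩
  have h1 : 100 ≤ (t : ℝ) * (lam * voteCorr lam n) ^ 2 / 16 := by
    have : ((lam : ℝ) * (m / 8)) ^ 2 ≤ (lam * voteCorr lam n) ^ 2 := by gcongr
    have := mul_le_mul_of_nonneg_left this t.cast_nonneg
    nlinarith
  rw [exp_neg, inv_le_comm₀ (exp_pos _) (by norm_num)]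
  have := add_one_le_exp ((t : ℝ) * (lam * voteCorr lam n) ^ 2 / 16)
  norm_num at this ⊢
  linarith

/-- Gibbs' inequality for the majority learner: its output is a function of the data, so the mutual
information is at most the cross entropy of the output with respect to any subdistribution. -/
theorem mutualInfo_majorityLearner_le (t : ℕ) (s : ℝ) (q : stdSimplex ℝ (Fin n → Cube d))
    {r : (Cube d → Bool) → ℝ} (hr : ∀ h, 0 ≤ r h) (hr1 : ∑ h, r h ≤ 1)
    (hpos : ∀ u : Cube d, 0 < r (linearClassifier t s u)) :
    mutualInfo q (majorityLearner n d t s).run ≤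
      ∑ S, q S * (-log (r (linearClassifier t s (majorityVote S)))) := by
  have hent : 0 ≤ ∑ S, q S * entropy ((majorityLearner n d t s).run S) :=
    Finset.sum_nonneg fun S _ => mul_nonneg (q.2.1 S) (entropy_nonneg _)
  have hmix : ∀ F : (Cube d → Bool) → ℝ, ∑ h, mix q (majorityLearner n d t s).run h * F h =
      ∑ S, q S * F (linearClassifier t s (majorityVote S)) := fun F => by
    change ∑ h, (∑ S, q S * (majorityLearner n d t s).run S h) * F h = _
    simp only [← sum_majorityLearner_run, Finset.mul_sum, Finset.sum_mul]
    rw [Finset.sum_comm]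
    exact Finset.sum_congr rfl fun _ _ => Finset.sum_congr rfl fun _ _ => by ring
  have h := entropy_le_cross (mix q (majorityLearner n d t s).run) hr hr1 fun h h0 => by
    refine Finset.sum_eq_zero fun S _ => ?_
    have hne : h ≠ linearClassifier t s (majorityVote S) := fun e => (hpos _).ne' (e ▸ h0)
    have : (majorityLearner n d t s).run S h = 0 := Pi.single_eq_of_ne hne _
    rw [this, mul_zero]
  rw [hmix] at h
  unfold mutualInfo
  linarith

/-- The classifier depends only on the first `t` signs of the vote, so it takes at most `2 ^ t`
values. -/
theorem mem_majorityLearner_le_mul_log_two (t : ℕ) (s : ℝ) :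
    (boolClustering d lam).mem (majorityLearner n d t s) ≤ t * log 2 := by
  classical
  set P := boolClustering d lam
  let R : Finset (Cube d → Bool) := Finset.univ.image fun w : Fin t → ℤˣ =>
    linearClassifier t s fun j => if h : (j : ℕ) < t then w ⟨j, h⟩ else 1
  have hmemR : ∀ u : Cube d, linearClassifier t s u ∈ R := fun u => by
    refine Finset.mem_image.2 ⟨fun i => if h : (i : ℕ) < d then u ⟨i, h⟩ else 1,
      Finset.mem_univ _, ?_⟩
    funext x
    have e : ∀ j : Fin d, (if (j : ℕ) < t then
        ((((if (j : ℕ) < t then u j else 1 : ℤˣ) : ℤ) * (x j : ℤ) : ℤ) : ℝ) else 0) =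
        if (j : ℕ) < t then (((u j : ℤ) * (x j : ℤ) : ℤ) : ℝ) else 0 := fun j => by
      split_ifs <;> rfl
    simp only [linearClassifier, Fin.is_lt, Fin.eta, dite_eq_ite, if_true, e]
  let r : (Cube d → Bool) → ℝ := fun h => if h ∈ R then (1 / 2) ^ t else 0
  have hcard : (R.card : ℝ) ≤ 2 ^ t := by
    have : R.card ≤ 2 ^ t := Finset.card_image_le.trans (by simp)
    exact_mod_cast this
  have key : ∀ θ, mutualInfo (P.dataLaw n θ) (majorityLearner n d t s).run ≤ t * log 2 :=
      fun θ => by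
    refine (mutualInfo_majorityLearner_le t s (P.dataLaw n θ) (r := r) (fun h => ?_) ?_
      fun u => ?_).trans (le_of_eq ?_)
    · simp only [r]; split_ifs <;> positivity
    · simp only [r]
      rw [Finset.sum_ite_mem, Finset.univ_inter, Finset.sum_const, nsmul_eq_mul]
      calc (R.card : ℝ) * (1 / 2) ^ t ≤ 2 ^ t * (1 / 2) ^ t := by gcongr
        _ = 1 := by rw [← mul_pow]; norm_num
    · simp only [r, hmemR, if_true]; positivity
    · have h1 : ∑ S, P.dataLaw n θ S = 1 := (P.dataLaw n θ).2.2
      simp only [r, hmemR, if_true]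
      rw [← Finset.sum_mul, h1, log_pow, one_div, log_inv]
      ring
  have hprior : ∑ θ, P.prior θ = 1 := P.prior.2.2
  calc P.mem (majorityLearner n d t s) ≤ ∑ θ, P.prior θ * (t * log 2) :=
        Finset.sum_le_sum fun θ _ => mul_le_mul_of_nonneg_left (key θ) (P.prior.2.1 θ)
    _ = _ := by rw [← Finset.sum_mul, hprior, one_mul]

/-- A coordinate of the data set has the law of `n` noisy copies of a sign. -/
theorem sum_dataLaw_column (θ : Cube d) (i : Fin d) (φ : (Fin n → ℤˣ) → ℝ) :
    ∑ S, (boolClustering d lam).dataLaw n θ S * φ (fun k => S k i) =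
      ∑ y, sampleLaw lam n (θ i) y * φ y := by
  rw [sum_dataLaw]
  have e : ∀ Y : Fin d → Fin n → ℤˣ, (∏ j, sampleLaw lam n (θ j) (Y j)) * φ (Y i) =
      ∏ j, sampleLaw lam n (θ j) (Y j) * if j = i then φ (Y j) else 1 := fun Y => by
    rw [Finset.prod_mul_distrib, Finset.prod_ite_eq' Finset.univ i, if_pos (Finset.mem_univ i)]
  simp only [e]
  rw [← Fintype.prod_sum fun (j : Fin d) y => sampleLaw lam n (θ j) y * if j = i then φ y else 1,
    Finset.prod_eq_single i]
  · simp
  · intro j _ hj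
    simp only [hj, if_false, mul_one]
    exact (sampleLaw lam n (θ j)).2.2
  · simp

/-- Since the majority vote is wrong on a coordinate with exponentially small probability, it has
exponentially small entropy given `θ`. The reference law of the vote flips each coordinate of `θ`
with probability `exp (-lam² n / 2) / 2`. -/
theorem mem_majorityLearner_le_exp (t : ℕ) (s : ℝ) :
    (boolClustering d lam).mem (majorityLearner n d t s) ≤ 2 * d * exp (-(n * lam ^ 2 / 4)) := by
  classical
  set P := boolClustering d lam
  set ε := exp (-(n * (lam : ℝ) ^ 2 / 4)) with hε
  have hε0 : 0 < ε := exp_pos _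
  have hε1 : ε ≤ 1 := exp_le_one_iff.2 (by have : 0 ≤ n * (lam : ℝ) ^ 2 := by positivity
                                           linarith)
  have hε2 : ε ^ 2 = exp (-(n * (lam : ℝ) ^ 2 / 2)) := by
    rw [hε, ← exp_nat_mul]; push_cast; ring_nf
  have hsq : ε ^ 2 ≤ 1 := pow_le_one₀ hε0.le hε1
  have hsq0 : 0 < ε ^ 2 := by positivity
  let p : Set.Icc (0 : ℝ) 1 := ⟨ε ^ 2 / 2, by positivity, by linarith⟩
  have hflip : ∀ x y, flipDist p x y = if y = x then 1 - ε ^ 2 / 2 else ε ^ 2 / 2 := fun x y => by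
    change (if y ≠ x then ε ^ 2 / 2 else 1 - ε ^ 2 / 2) = _
    simp only [ne_eq, ite_not]
  have hflip0 : ∀ x y, 0 < flipDist p x y := fun x y => by
    rw [hflip]; split_ifs <;> linarith
  -- the contribution of a single coordinate
  have hcol : ∀ x : ℤˣ, ∑ y, sampleLaw lam n x y * (-log (flipDist p x (signVote y))) ≤ 2 * ε :=
    fun x => by
    have hw := sum_sampleLaw_vote_ne_le lam n x
    rw [← hε2] at hw
    have h1 : ∑ y, sampleLaw lam n x y = 1 := (sampleLaw lam n x).2.2
    have hlog : -log (1 - ε ^ 2 / 2) ≤ ε ^ 2 := by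
      have h2 := one_sub_inv_le_log_of_pos (x := 1 - ε ^ 2 / 2) (by linarith)
      have h3 : (1 - ε ^ 2 / 2)⁻¹ ≤ 1 + ε ^ 2 := by
        rw [inv_le_iff_one_le_mul₀ (by linarith)]
        nlinarith
      linarith
    have hlog0 : 0 ≤ -log (1 - ε ^ 2 / 2) :=
      neg_nonneg.2 (log_nonpos (by linarith) (by linarith))
    have hlogp0 : 0 ≤ -log (ε ^ 2 / 2) := neg_nonneg.2 (log_nonpos (by linarith) (by linarith))
    have hlogp : ε ^ 2 * -log (ε ^ 2 / 2) ≤ 2 * ε - ε ^ 2 := by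
      have h2 := one_sub_inv_le_log_of_pos hε0
      have h3 := mul_le_mul_of_nonneg_left h2 hsq0.le
      have h4 : ε ^ 2 * (1 - ε⁻¹) = ε ^ 2 - ε := by field_simp
      have h5 := mul_le_mul_of_nonneg_left log_two_lt_d9.le hsq0.le
      rw [log_div hsq0.ne' (by norm_num), log_pow]
      push_cast
      nlinarith
    have hpt : ∀ y : Fin n → ℤˣ, sampleLaw lam n x y * (-log (flipDist p x (signVote y))) ≤
        (if signVote y = x then 0 else sampleLaw lam n x y) * -log (ε ^ 2 / 2) +
          sampleLaw lam n x y * -log (1 - ε ^ 2 / 2) := fun y => by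
      have hy : 0 ≤ sampleLaw lam n x y := (sampleLaw lam n x).2.1 y
      rw [hflip]
      split_ifs with h
      · simp
      · exact le_add_of_nonneg_right (mul_nonneg hy hlog0)
    refine (Finset.sum_le_sum fun y _ => hpt y).trans ?_
    rw [Finset.sum_add_distrib, ← Finset.sum_mul, ← Finset.sum_mul, h1, one_mul]
    have := mul_le_mul_of_nonneg_right hw hlogp0
    linarith
  have key : ∀ θ, mutualInfo (P.dataLaw n θ) (majorityLearner n d t s).run ≤ d * (2 * ε) :=
    fun θ => by
    let r : (Cube d → Bool) → ℝ := fun h =>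
      ∑ u : Cube d, if linearClassifier t s u = h then bsc p θ u else 0
    have hb0 : ∀ u : Cube d, 0 < bsc p θ u := fun u => by
      change 0 < ∏ j, flipDist p (θ j) (u j)
      exact Finset.prod_pos fun j _ => hflip0 _ _
    have hr0 : ∀ h, ∀ u ∈ Finset.univ, 0 ≤ if linearClassifier t s u = h then bsc p θ u else 0 :=
      fun h u _ => by split_ifs; exacts [(hb0 u).le, le_rfl]
    have hru : ∀ u, bsc p θ u ≤ r (linearClassifier t s u) := fun u => by
      have := Finset.single_le_sum (hr0 (linearClassifier t s u)) (Finset.mem_univ u)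
      simpa using this
    refine (mutualInfo_majorityLearner_le t s (P.dataLaw n θ) (r := r)
      (fun h => Finset.sum_nonneg (hr0 h)) (le_of_eq ?_) fun u => (hb0 u).trans_le (hru u)).trans ?_
    · simp only [r]
      rw [Finset.sum_comm]
      simp only [Finset.sum_ite_eq, Finset.mem_univ, if_true]
      exact (bsc p θ).2.2
    · calc ∑ S, P.dataLaw n θ S * -log (r (linearClassifier t s (majorityVote S)))
          ≤ ∑ S, P.dataLaw n θ S * ∑ j, -log (flipDist p (θ j) (signVote fun i => S i j)) := by
            refine Finset.sum_le_sum fun S _ => mul_le_mul_of_nonneg_left ?_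
              ((P.dataLaw n θ).2.1 S)
            refine (neg_le_neg (log_le_log (hb0 _) (hru (majorityVote S)))).trans (le_of_eq ?_)
            rw [Finset.sum_neg_distrib, ← log_prod fun j _ => (hflip0 _ _).ne']
            rfl
        _ = ∑ j, ∑ y, sampleLaw lam n (θ j) y * -log (flipDist p (θ j) (signVote y)) := by
            simp only [Finset.mul_sum]
            rw [Finset.sum_comm]
            exact Finset.sum_congr rfl fun j _ =>
              sum_dataLaw_column lam θ j fun y => -log (flipDist p (θ j) (signVote y))
        _ ≤ ∑ _j : Fin d, 2 * ε := Finset.sum_le_sum fun j _ => hcol (θ j)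
        _ = d * (2 * ε) := by simp
  have hprior : ∑ θ, P.prior θ = 1 := P.prior.2.2
  calc P.mem (majorityLearner n d t s) ≤ ∑ θ, P.prior θ * (d * (2 * ε)) :=
        Finset.sum_le_sum fun θ _ => mul_le_mul_of_nonneg_left (key θ) (P.prior.2.1 θ)
    _ = _ := by rw [← Finset.sum_mul, hprior]; ring
end

/-! ### The scaling `lam = C * d ^ (-1 / 4)` -/

section
variable {d n : ℕ} {lam : Set.Ioo (0 : ℝ) 1} {C : ℝ}

theorem sq_mul_sqrt_eq (hd : 1 ≤ d) (h : (lam : ℝ) = C * (d : ℝ) ^ (-(1 / 4) : ℝ)) :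
    (lam : ℝ) ^ 2 * √(d : ℝ) = C ^ 2 := by
  have hd0 : (0 : ℝ) < d := by exact_mod_cast hd
  have e : ((d : ℝ) ^ (-(1 / 4) : ℝ)) ^ 2 * √(d : ℝ) = 1 := by
    rw [sqrt_eq_rpow, ← rpow_natCast, ← rpow_mul hd0.le, ← rpow_add hd0]
    norm_num
  rw [h, mul_pow, mul_assoc, e, mul_one]

theorem pow_four_mul_eq (hd : 1 ≤ d) (h : (lam : ℝ) = C * (d : ℝ) ^ (-(1 / 4) : ℝ)) :
    (lam : ℝ) ^ 4 * d = C ^ 4 := by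
  have h1 := sq_mul_sqrt_eq hd h
  have h2 : √(d : ℝ) ^ 2 = d := sq_sqrt d.cast_nonneg
  calc (lam : ℝ) ^ 4 * d = ((lam : ℝ) ^ 2 * √(d : ℝ)) ^ 2 := by rw [mul_pow, h2]; ring
    _ = C ^ 4 := by rw [h1]; ring

/-- The condition `lam < 1` forces the dimension to exceed `C ^ 4`. -/
theorem pow_four_le_dim (hd : 1 ≤ d) (h : (lam : ℝ) = C * (d : ℝ) ^ (-(1 / 4) : ℝ)) :
    C ^ 4 ≤ d := by
  rw [← pow_four_mul_eq hd h]
  exact mul_le_of_le_one_left d.cast_nonneg (pow_le_one₀ lam.2.1.le lam.2.2.le)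

theorem two_le_log {x : ℝ} (hx : 8 ≤ x) : 2 ≤ log x := by
  have h1 : log ((2 : ℝ) ^ 3) ≤ log x := log_le_log (by norm_num) (by linarith)
  rw [log_pow] at h1
  have := log_two_gt_d9
  push_cast at h1
  linarith

theorem dim_ge (hC : 1000 ≤ C) (hd : 1 ≤ d) (h : (lam : ℝ) = C * (d : ℝ) ^ (-(1 / 4) : ℝ)) :
    (1000 : ℝ) ≤ d := by
  refine le_trans ?_ (pow_four_le_dim hd h)
  exact hC.trans (le_self_pow₀ (by linarith) (by norm_num))

theorem exists_err_majorityLearner_le (hC : 1000 ≤ C) (hd : 1 ≤ d) (hn : 1 ≤ n)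
    (h : (lam : ℝ) = C * (d : ℝ) ^ (-(1 / 4) : ℝ)) :
    ∃ s, (boolClustering d lam).err (majorityLearner n d d s) ≤ 0.01 := by
  have hn0 : (1 : ℝ) ≤ n := by exact_mod_cast hn
  refine err_majorityLearner_le_of_le lam le_rfl hn lam.2.1.le lam.2.2.le
    (le_mul_of_one_le_right (sq_nonneg _) hn0) ?_
  have h1 := pow_four_mul_eq hd h
  have h2 : (1000 : ℝ) ^ 4 ≤ C ^ 4 := by gcongr
  nlinarith

theorem exists_majorityLearner_mem_le_div (hC : 1000 ≤ C) (hd : 1 ≤ d) (hn : 1 ≤ n)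
    (h : (lam : ℝ) = C * (d : ℝ) ^ (-(1 / 4) : ℝ)) (hnd : (n : ℝ) ≤ √(d : ℝ)) :
    ∃ (t : ℕ) (s : ℝ), (boolClustering d lam).err (majorityLearner n d t s) ≤ 0.01 ∧
      (boolClustering d lam).mem (majorityLearner n d t s) ≤ 2 * (d / n) := by
  have hn0 : (1 : ℝ) ≤ n := by exact_mod_cast hn
  have hd0 : (1 : ℝ) ≤ d := by exact_mod_cast hd
  have hl0 := lam.2.1
  -- about `d / n` coordinates are just enough for accuracy
  set t := ⌈(d : ℝ) / n⌉₊ with ht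
  have hsd : √(d : ℝ) ^ 2 = d := sq_sqrt d.cast_nonneg
  have ht1 : (d : ℝ) / n ≤ t := Nat.le_ceil _
  have ht2 : t ≤ d := Nat.ceil_le.2 (div_le_self d.cast_nonneg hn0)
  have ht3 : (t : ℝ) ≤ d / n + 1 := (Nat.ceil_lt_add_one (by positivity)).le
  have hs1 : √(d : ℝ) ≤ d / n := by
    rw [le_div_iff₀ (by linarith)]
    nlinarith [sqrt_nonneg (d : ℝ)]
  have ht4 : 1 ≤ (d : ℝ) / n := by linarith
  have herr : ∃ s, (boolClustering d lam).err (majorityLearner n d t s) ≤ 0.01 := by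
    rcases le_total ((lam : ℝ) ^ 2 * n) 1 with hc | hc
    · -- weak majority votes, with correlation of order `lam √n`
      have hm := sq_sqrt (by positivity : 0 ≤ (lam : ℝ) ^ 2 * n)
      refine err_majorityLearner_le_of_le lam ht2 hn (sqrt_nonneg ((lam : ℝ) ^ 2 * n))
        (sqrt_le_one.2 hc) hm.le ?_
      rw [hm]
      have h1 := pow_four_mul_eq hd h
      have h2 : (1000 : ℝ) ^ 4 ≤ C ^ 4 := by gcongr
      have h3 : (d : ℝ) / n * ((lam : ℝ) ^ 2 * (lam ^ 2 * n)) = lam ^ 4 * d := by field_simp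
      have h4 := mul_le_mul_of_nonneg_right ht1
        (by positivity : 0 ≤ (lam : ℝ) ^ 2 * (lam ^ 2 * n))
      rw [h3] at h4
      linarith
    · -- strong majority votes, with correlation of constant order
      refine err_majorityLearner_le_of_le lam ht2 hn zero_le_one le_rfl (by linarith) ?_
      have h1 := sq_mul_sqrt_eq hd h
      have h2 : (1000 : ℝ) ^ 2 ≤ C ^ 2 := by gcongr
      have h4 := mul_le_mul_of_nonneg_right (hs1.trans ht1) (sq_nonneg (lam : ℝ))
      linarith
  obtain ⟨s, hs⟩ := herr
  refine ⟨t, s, hs, (mem_majorityLearner_le_mul_log_two lam t s).trans ?_⟩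
  have := mul_le_of_le_one_right (t.cast_nonneg (α := ℝ)) (by have := log_two_lt_d9; linarith :
    log 2 ≤ 1)
  linarith

theorem mem_majorityLearner_le (hC : 1000 ≤ C) (hd : 1 ≤ d)
    (h : (lam : ℝ) = C * (d : ℝ) ^ (-(1 / 4) : ℝ)) (s : ℝ) :
    (boolClustering d lam).mem (majorityLearner n d d s) ≤ 2 * d * exp (-(n / √(d : ℝ))) := by
  have hd0 : (0 : ℝ) < d := by exact_mod_cast hd
  have hr : 0 < √(d : ℝ) := sqrt_pos.2 hd0
  refine (mem_majorityLearner_le_exp lam d s).trans ?_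
  refine mul_le_mul_of_nonneg_left (exp_le_exp.2 ?_) (by positivity)
  have h1 : (lam : ℝ) ^ 2 = C ^ 2 / √(d : ℝ) := by
    rw [eq_div_iff hr.ne', sq_mul_sqrt_eq hd h]
  have h2 : 1 / √(d : ℝ) ≤ lam ^ 2 / 4 := by
    rw [h1, div_div, div_le_div_iff₀ hr (by positivity)]
    have h3 : 4 ≤ C ^ 2 := by nlinarith
    have h4 := mul_le_mul_of_nonneg_right h3 hr.le
    linarith
  have h3 := mul_le_mul_of_nonneg_left h2 (n.cast_nonneg (α := ℝ))
  rw [mul_one_div] at h3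
  linarith

variable {M : Type} [Fintype M]

theorem cAlpha_le_log_card {α : ℝ} (h0 : 0 < α) (h1 : α < 1 / 2) (A : Learner n (Cube d) M)
    (herr : (boolClustering d lam).err A ≤ α) : cAlpha α ≤ 64 * log (Fintype.card M) := by
  have hne : Nonempty M := by
    by_contra hempty
    rw [not_nonempty_iff] at hempty
    have := (A.run fun _ _ => 1).2.2
    simp at this
  have := cAlpha_le_testInfo lam A h0 h1 herr
  have := testInfo_le_log_card lam A
  linarith

theorem cAlpha_le_dim {α : ℝ} (h0 : 0 < α) (h1 : α < 1 / 2) (A : Learner n (Cube d) M)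
    (herr : (boolClustering d lam).err A ≤ α) : cAlpha α ≤ 128 * (lam : ℝ) ^ 2 * d := by
  have h2 := cAlpha_le_testInfo lam A h0 h1 herr
  have h3 := testInfo_le lam A
  have h4 := mul_le_mul_of_nonneg_left (paramInfo_le_dim lam A)
    (by positivity : 0 ≤ 2 * (lam : ℝ) ^ 2)
  linarith

/-- When an accurate learner exists, the logarithm in the sample-size condition is at least `2`, so
the condition makes `lam² n` small. -/
theorem sq_mul_le_of_le_div_log (hC : 1000 ≤ C) (hd : 1 ≤ d)
    (h : (lam : ℝ) = C * (d : ℝ) ^ (-(1 / 4) : ℝ)) {α : ℝ} (h0 : 0 < α) (h1 : α < 1 / 2)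
    (A : Learner n (Cube d) M) (herr : (boolClustering d lam).err A ≤ α)
    (hn : (n : ℝ) ≤
      1 / (2000 * C ^ 2) * √(d : ℝ) / log (d * log (Fintype.card M) / cAlpha α)) :
    (lam : ℝ) ^ 2 * n ≤ 1 / 2000 := by
  have hCα := cAlpha_pos h0 h1
  have hd1 := dim_ge hC hd h
  have hL : 2 ≤ log (d * log (Fintype.card M) / cAlpha α) := by
    refine two_le_log ?_
    rw [le_div_iff₀ hCα]
    have := cAlpha_le_log_card h0 h1 A herr
    nlinarith
  have h2 : (n : ℝ) ≤ 1 / (2000 * C ^ 2) * √(d : ℝ) :=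
    hn.trans (div_le_self (by positivity) (by linarith))
  calc (lam : ℝ) ^ 2 * n ≤ lam ^ 2 * (1 / (2000 * C ^ 2) * √(d : ℝ)) := by gcongr
    _ = 1 / (2000 * C ^ 2) * (lam ^ 2 * √(d : ℝ)) := by ring
    _ = 1 / 2000 := by
        have : C ≠ 0 := by linarith
        rw [sq_mul_sqrt_eq hd h]
        field_simp
end

end ExcessMem

open ExcessMem
theorem theorem3 :
    ∃ κ > (0 : ℝ), ∃ K₁ > (0 : ℝ), ∃ K₂ > (0 : ℝ), ∃ C₀ > (0 : ℝ), ∀ C ≥ C₀,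
      -- one sample suffices for error 0.01
      (∀ (d : ℕ) (lam : Set.Ioo (0 : ℝ) 1), 1 ≤ d → (lam : ℝ) = C * (d : ℝ) ^ (-(1 / 4) : ℝ) →
        ∃ A : Learner 1 (Cube d) (Cube d → Bool), (boolClustering d lam).err A ≤ 0.01) ∧
      -- the memorization lower bound, for every finite model space
      (∀ (d n : ℕ) (lam : Set.Ioo (0 : ℝ) 1) (M : Type) [Fintype M] (α : ℝ),
        1 ≤ d → 1 ≤ n → (lam : ℝ) = C * (d : ℝ) ^ (-(1 / 4) : ℝ) → 0 < α → α < 1 / 2 →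
        ((κ * ((1 - 8 * (lam : ℝ) ^ 2 * n *
                Real.log (d * n * Real.log (Fintype.card M) / cAlpha α)) /
              ((lam : ℝ) ^ 4 * n * Real.log (d * n * Real.log (Fintype.card M) / cAlpha α)) *
              cAlpha α) : ℝ) : EReal) ≤ (boolClustering d lam).memInf n M α) ∧
      -- its consequences for model spaces of size at most `exp (d ^ D)`
      (∃ c > (0 : ℝ), ∀ D > (0 : ℝ), ∃ κ' > (0 : ℝ),
        ∀ (d n : ℕ) (lam : Set.Ioo (0 : ℝ) 1) (M : Type) [Fintype M],
          1 ≤ d → 1 ≤ n → (lam : ℝ) = C * (d : ℝ) ^ (-(1 / 4) : ℝ) →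
          (Fintype.card M : ℝ) ≤ Real.exp ((d : ℝ) ^ D) →
          (∀ α : ℝ, 0 < α → α < 1 / 2 →
            (n : ℝ) ≤ c * √(d : ℝ) / Real.log (d * Real.log (Fintype.card M) / cAlpha α) →
            ((κ' * ((1 - 8 * (lam : ℝ) ^ 2 * n * Real.log (d * n / cAlpha α)) /
                ((lam : ℝ) ^ 4 * n * Real.log (d * n / cAlpha α)) * cAlpha α) : ℝ) : EReal) ≤
              (boolClustering d lam).memInf n M α) ∧
          ((n : ℝ) ≤ c * √(d : ℝ) / Real.log (d * Real.log (Fintype.card M) / cAlpha (1 / 3)) →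
            ((κ' * (d / (n * Real.log d)) : ℝ) : EReal) ≤
              (boolClustering d lam).memInf n M (1 / 3))) ∧
      -- the matching upper bound, by a majority vote on the first `t` coordinates
      (∀ (d n : ℕ) (lam : Set.Ioo (0 : ℝ) 1),
        1 ≤ d → 1 ≤ n → (lam : ℝ) = C * (d : ℝ) ^ (-(1 / 4) : ℝ) → (n : ℝ) ≤ √(d : ℝ) →
        ∃ (t : ℕ) (s : ℝ),
          (boolClustering d lam).err (majorityLearner n d t s) ≤ 0.01 ∧
          (boolClustering d lam).mem (majorityLearner n d t s) ≤ K₁ * (d / n)) ∧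
      -- the upper bound for all `n`, by a majority vote on all coordinates
      (∃ B : ℕ → ℝ, ∀ (d n : ℕ) (lam : Set.Ioo (0 : ℝ) 1),
        1 ≤ d → 1 ≤ n → (lam : ℝ) = C * (d : ℝ) ^ (-(1 / 4) : ℝ) →
        ∃ s : ℝ,
          (boolClustering d lam).err (majorityLearner n d d s) ≤ 0.01 ∧
          (boolClustering d lam).mem (majorityLearner n d d s) ≤
            K₂ * ((d : ℝ) ^ 2 * n * Real.exp (-(n / √(d : ℝ)))) ∧
          ∀ k : ℕ, B k * √(d : ℝ) * Real.log d ≤ n →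
            (boolClustering d lam).mem (majorityLearner n d d s) ≤ 1 / (d : ℝ) ^ k) := by
  refine ⟨1 / 2048, by norm_num, 2, by norm_num, 2, by norm_num, 1000, by norm_num,
    fun C hC => ⟨?_, ?_, ?_, ?_, ?_⟩⟩
  · intro d lam hd hlam
    obtain ⟨s, hs⟩ := exists_err_majorityLearner_le hC hd le_rfl hlam
    exact ⟨_, hs⟩
  · intro d n lam M _ α hd hn hlam h0 h1
    refine le_iInf₂ fun A hA => EReal.coe_le_coe_iff.2 (mem_lower_bound lam A h0 h1 hn hA ?_)
    have hn0 : (1 : ℝ) ≤ n := by exact_mod_cast hn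
    have hd1 := dim_ge hC hd hlam
    refine two_le_log ?_
    rw [le_div_iff₀ (cAlpha_pos h0 h1)]
    have h2 := cAlpha_le_log_card h0 h1 A hA
    have h3 : (1000 : ℝ) ≤ d * n := by nlinarith
    have h4 := cAlpha_pos h0 h1
    nlinarith
  · have hC0 : 0 < C := by linarith
    have hthird : 0 < cAlpha (1 / 3) := cAlpha_pos (by norm_num) (by norm_num)
    refine ⟨1 / (2000 * C ^ 2), by positivity, fun D _ =>
      ⟨min (1 / 2048) (cAlpha (1 / 3) / (8192 * C ^ 4)), by positivity, ?_⟩⟩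
    intro d n lam M _ hd hn hlam _
    have hn0 : (1 : ℝ) ≤ n := by exact_mod_cast hn
    have hd1 := dim_ge hC hd hlam
    have hl0 := lam.2.1
    refine ⟨fun α h0 h1 hle => le_iInf₂ fun A hA => EReal.coe_le_coe_iff.2 ?_,
      fun hle => le_iInf₂ fun A hA => EReal.coe_le_coe_iff.2 ?_⟩
    · have hsmall := sq_mul_le_of_le_div_log hC hd hlam h0 h1 A hA hle
      have hB : 2 ≤ Real.log (d * n / cAlpha α) := by
        refine two_le_log ?_
        rw [le_div_iff₀ (cAlpha_pos h0 h1)]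
        have h2 := cAlpha_le_dim h0 h1 A hA
        have h3 : (lam : ℝ) ^ 2 ≤ 1 / 2000 :=
          (le_mul_of_one_le_right (sq_nonneg _) hn0).trans hsmall
        nlinarith
      have hmain := mem_lower_bound lam A h0 h1 hn hA hB
      set X := (1 - 8 * (lam : ℝ) ^ 2 * n * Real.log (d * n / cAlpha α)) /
        ((lam : ℝ) ^ 4 * n * Real.log (d * n / cAlpha α)) * cAlpha α
      rcases le_total X 0 with hX | hX
      · exact (mul_nonpos_of_nonneg_of_nonpos (by positivity) hX).trans (mem_nonneg lam A)
      · exact (mul_le_mul_of_nonneg_right (min_le_left _ _) hX).trans hmain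
    · have hsmall := sq_mul_le_of_le_div_log hC hd hlam (by norm_num) (by norm_num) A hA hle
      refine le_trans ?_ (mem_lower_bound lam A (by norm_num) (by norm_num) hn hA le_rfl)
      have hlog : 1 ≤ Real.log d := by have := two_le_log (x := d) (by linarith); linarith
      have hl4 : (lam : ℝ) ^ 4 = C ^ 4 / d := by
        rw [eq_div_iff (by linarith), pow_four_mul_eq hd hlam]
      calc min (1 / 2048) (cAlpha (1 / 3) / (8192 * C ^ 4)) * (d / (n * Real.log d))
          ≤ cAlpha (1 / 3) / (8192 * C ^ 4) * (d / (n * 1)) := by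
            gcongr
            exact min_le_right _ _
        _ = 1 / 2048 * ((1 / 2) / ((lam : ℝ) ^ 4 * n * 2) * cAlpha (1 / 3)) := by
            rw [hl4]; field_simp; norm_num
        _ ≤ 1 / 2048 * ((1 - 8 * (lam : ℝ) ^ 2 * n * 2) / ((lam : ℝ) ^ 4 * n * 2) *
              cAlpha (1 / 3)) := by
            gcongr
            linarith
  · intro d n lam hd hn hlam hnd
    exact exists_majorityLearner_mem_le_div hC hd hn hlam hnd
  · refine ⟨fun k => k + 2, fun d n lam hd hn hlam => ?_⟩
    obtain ⟨s, hs⟩ := exists_err_majorityLearner_le hC hd hn hlam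
    have hmem := mem_majorityLearner_le (n := n) hC hd hlam s
    have hn0 : (1 : ℝ) ≤ n := by exact_mod_cast hn
    have hd1 := dim_ge hC hd hlam
    refine ⟨s, hs, hmem.trans ?_, fun k hk => hmem.trans ?_⟩
    · rw [mul_assoc]
      gcongr
      nlinarith
    · have hr : 0 < √(d : ℝ) := Real.sqrt_pos.2 (by linarith)
      have h1 : (k + 2) * Real.log d ≤ n / √(d : ℝ) := by
        rw [le_div_iff₀ hr]
        linarith
      have h2 : Real.exp (-(n / √(d : ℝ))) ≤ 1 / (d : ℝ) ^ (k + 2) := by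
        rw [Real.exp_neg, ← one_div]
        refine one_div_le_one_div_of_le (by positivity) ?_
        rw [← Real.exp_log (by positivity : 0 < (d : ℝ) ^ (k + 2)), Real.exp_le_exp, Real.log_pow]
        push_cast
        exact h1
      calc 2 * d * Real.exp (-(n / √(d : ℝ))) ≤ 2 * d * (1 / (d : ℝ) ^ (k + 2)) := by gcongr
        _ = 2 / d * (1 / (d : ℝ) ^ k) := by rw [pow_add]; field_simp
        _ ≤ 1 * (1 / (d : ℝ) ^ k) := by
            gcongr
            rw [div_le_one (by linarith)]
            linarith
        _ = 1 / (d : ℝ) ^ k := one_mul _
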